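/- Digraphs are finite and may have multiple edges; $G\setminus e$ denotes $G$ with one copy of the edge $e$ deleted, and $G^R$ is $G$ with all edges reversed. A digraph is \emph{twinless strongly connected} if it has a strongly connected spanning subgraph without a pair of antiparallel edges; the TSCCs of $G$ are its maximal twinless strongly connected subgraphs. Vertices $x,y$ are \emph{2-edge twinless strongly connected} in $G$, written $x\leftrightarrow_{2et}y$, if they belong to a common set $C$ that is maximal among the sets $C$ of vertices such that any two vertices of $C$ lie in the same TSCC of $G\setminus e$, for every edge $e$ of $G$. Let $G_s$ be a strongly connected digraph $G$ with a start vertex $s$. Let $d(v)$ denote the immediate dominator of $v\ne s$ and $D(v)$ the set of vertices dominated by $v$ (the descendants of $v$ in the dominator tree). A \emph{bridge} of $G_s$ is an edge $(a,b)$ whose deletion makes $b$ unreachable from $s$; then $a=d(b)$, and $b$ is called \emph{marked}. Deleting all bridges from the dominator tree leaves a forest; for $r$ marked or $r=s$, $T(r)$ is its tree with root $r$. The \emph{auxiliary graph} $H(G_s,r)$ is obtained from $G$ by shrinking $D(z)$ into $z$ for every marked $z$ with $d(z)\in T(r)$ and, if $r\neq s$, shrinking all vertices outside $D(r)$ into $d(r)$;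 self-loops are removed and multiple edges are replaced by double edges. The vertices of $T(r)$ are called ordinary in $H(G_s,r)$. Put $H_r=H(G_s,r)$ for $r=s$ or $r$ a marked vertex of $G_s$. Consider $H_r^R$ as a flow graph with start vertex $r$, and put $H_{rr'}=H(H_r^R,r')$ for $r'=r$ or $r'$ a marked vertex of $H_r^R$. An \emph{$oo$-vertex} of $H_{rr'}$ is a vertex that is ordinary both in $H_r$ and in $H_{rr'}$. For a strongly connected digraph $K$ with an edge $(a,b)$ such that $K\setminus(a,b)$ is not strongly connected, $S(K,(a,b))$ is the set of the digraphs $C'$ obtained as follows from the strongly connected components $C$ of $K\setminus(a,b)$: $C'$ has vertex set $V(C)\cup\{a,b\}$, and its edges are the edges of $K$ with both ends in $C$, an edge $(u,a)$ for every edge $(u,w)$ of $K$ with $u\in C$, $w\notin C$, an edge $(b,v)$ for every edge $(w,v)$ of $K$ with $w\notin C$, $v\in C$, and the edge $(a,b)$. \textbf{Corollary.} Let $G_s$ be a strongly connected digraph and let $x,y$ be two vertices of $G_s$. Then $x\leftrightarrow_{2et}y$ in $G_s$ if and only if there is a digraph $A$ such that $x$ and $y$ are both vertices of $A$ that are $oo$-vertices,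 $x\leftrightarrow_{2et}y$ in $A$, and $A$ is one of the following: (1) $H_{ss}$; (2) $H_{rr}$, for a marked vertex $r$ of $G_s$; (3) a graph in $S(H_{sr},(d(r),r))$, for a marked vertex $r$ of $H_s^R$, where $d(r)$ is taken in $H_s^R$; (4) a graph in $S(H_{rr'},(d(r'),r'))$, for a marked vertex $r$ of $G_s$ and a marked vertex $r'$ of $H_r^R$, where $d(r')$ is taken in $H_r^R$. Here, in (3) and (4), the $oo$-vertices of $A$ are the vertices of $A$ that are $oo$-vertices of $H_{sr}$ and of $H_{rr'}$, respectively. -/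

import Mathlib

/-- A directed multigraph with vertices in `V`: a vertex set, and for all `u`, `v` the number
`mult u v` of edges `(u, v)`. -/
@[ext]
structure MultiDigraph (V : Type*) where
  verts : Set V
  mult : V → V → ℕ
  left_mem : ∀ {u v : V}, 0 < mult u v → u ∈ verts
  right_mem : ∀ {u v : V}, 0 < mult u v → v ∈ verts

namespace MultiDigraph

section Connectivity

variable {V : Type*}

/-- `H ≤ G` means that `H` is a subgraph of `G`. -/
instance : LE (MultiDigraph V) :=
  ⟨fun H G => H.verts ⊆ G.verts ∧ ∀ u v, H.mult u v ≤ G.mult u v⟩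

/-- The reverse digraph `Gᴿ`. -/
def reverse (G : MultiDigraph V) : MultiDigraph V where
  verts := G.verts
  mult u v := G.mult v u
  left_mem h := G.right_mem h
  right_mem h := G.left_mem h

open Classical in
/-- `G \ (a, b)`: one copy of the edge `(a, b)` is deleted. -/
noncomputable def deleteEdge (G : MultiDigraph V) (a b : V) : MultiDigraph V where
  verts := G.verts
  mult u v := if u = a ∧ v = b then G.mult u v - 1 else G.mult u v
  left_mem {u v} h := G.left_mem (v := v) (by split_ifs at h <;> omega)
  right_mem {u v} h := G.right_mem (u := u) (by split_ifs at h <;> omega)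

/-- `G.IsWalk u v l`: the list `l` is the list of vertices of a directed walk from `u` to `v`.
(Every walk contains a path with the same ends, so reachability and dominance may be defined
with walks or with paths.) -/
inductive IsWalk (G : MultiDigraph V) : V → V → List V → Prop
  | single {v : V} (hv : v ∈ G.verts) : IsWalk G v v [v]
  | cons {u w v : V} {l : List V} (h : 0 < G.mult u w) (hl : IsWalk G w v l) :
      IsWalk G u v (u :: l)

/-- `u` reaches `v` in `G`. -/
def Reaches (G : MultiDigraph V) (u v : V) : Prop := ∃ l, G.IsWalk u v l

def StronglyConnected (G : MultiDigraph V) : Prop :=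
  ∀ u ∈ G.verts, ∀ v ∈ G.verts, G.Reaches u v

/-- The strongly connected components: the maximal strongly connected subgraphs. -/
def IsSCC (G C : MultiDigraph V) : Prop :=
  Maximal (fun H : MultiDigraph V => H ≤ G ∧ H.StronglyConnected) C

/-- There is no pair of twin (antiparallel) edges. -/
def NoTwins (G : MultiDigraph V) : Prop :=
  ∀ u v, u ≠ v → ¬ (0 < G.mult u v ∧ 0 < G.mult v u)

/-- `G` has a strongly connected spanning subgraph without twin edges. -/
def TwinlessStronglyConnected (G : MultiDigraph V) : Prop :=
  ∃ K : MultiDigraph V, K ≤ G ∧ K.verts = G.verts ∧ K.StronglyConnected ∧ K.NoTwins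

/-- The twinless strongly connected components: the maximal twinless strongly connected
subgraphs. -/
def IsTSCC (G C : MultiDigraph V) : Prop :=
  Maximal (fun H : MultiDigraph V => H ≤ G ∧ H.TwinlessStronglyConnected) C

/-- `u` and `v` belong to the same twinless strongly connected component. -/
def TwinlessConn (G : MultiDigraph V) (u v : V) : Prop :=
  ∃ C : MultiDigraph V, G.IsTSCC C ∧ u ∈ C.verts ∧ v ∈ C.verts

/-- The 2-edge twinless strongly connected components: the maximal sets of vertices any two of
which are in the same twinless strongly connected component of `G \ e`, for every edge `e`. -/
def IsTwoEdgeTSCC (G : MultiDigraph V) (C : Set V) : Prop :=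
  Maximal (fun D : Set V => D ⊆ G.verts ∧ ∀ u ∈ D, ∀ v ∈ D,
    ∀ a b, 0 < G.mult a b → (G.deleteEdge a b).TwinlessConn u v) C

/-- `u` and `v` are 2-edge twinless strongly connected in `G`. -/
def TwoEdgeTwinlessConn (G : MultiDigraph V) (u v : V) : Prop :=
  ∃ C : Set V, G.IsTwoEdgeTSCC C ∧ u ∈ C ∧ v ∈ C

end Connectivity

section FlowGraph

variable {V : Type*}

/-- `u` dominates `v` in the flow graph `G` with start vertex `s`; equivalently, `u` is an
ancestor of `v` in the dominator tree, i.e. `v` belongs to the subtree `D(u)`. -/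
def Dominates (G : MultiDigraph V) (s u v : V) : Prop :=
  u ∈ G.verts ∧ v ∈ G.verts ∧ ∀ l, G.IsWalk s v l → u ∈ l

/-- `d` is the immediate dominator `d(v)` of `v`, i.e. its parent in the dominator tree. -/
def IsIdom (G : MultiDigraph V) (s d v : V) : Prop :=
  G.Dominates s d v ∧ d ≠ v ∧ ∀ w, G.Dominates s w v → w ≠ v → G.Dominates s w d

/-- The edge `(a, b)` is a bridge of the flow graph `G` with start vertex `s`. -/
def IsBridge (G : MultiDigraph V) (s a b : V) : Prop :=
  0 < G.mult a b ∧ ¬ (G.deleteEdge a b).Reaches s b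

/-- Marked vertices: the heads of the bridges. -/
def Marked (G : MultiDigraph V) (s b : V) : Prop := ∃ a, G.IsBridge s a b

/-- The vertex set of `T(r)`, the tree with root `r` in the forest that is left of the dominator
tree when the bridges `(d(z), z)` are removed from it: the descendants `v` of `r` such that no
vertex other than `r` on the tree path from `r` to `v` is marked. -/
def tree (G : MultiDigraph V) (s r : V) : Set V :=
  {v | G.Dominates s r v ∧
    ∀ z, G.Dominates s r z → G.Dominates s z v → z ≠ r → ¬ G.Marked s z}

/-- `v` is shrunk into `a` in the construction of the auxiliary graph `H(G_s, r)`: vertices of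
`T(r)` stay as they are, `D(z)` is shrunk into `z` for every marked `z` with `d(z) ∈ T(r)`, and
for `r ≠ s` the vertices outside `D(r)` are shrunk into `d(r)`. -/
def ShrinksTo (G : MultiDigraph V) (s r v a : V) : Prop :=
  (v ∈ G.tree s r ∧ a = v) ∨
  (G.Marked s a ∧ (∃ d ∈ G.tree s r, G.IsIdom s d a) ∧ G.Dominates s a v) ∨
  (r ≠ s ∧ G.IsIdom s a r ∧ v ∈ G.verts ∧ ¬ G.Dominates s r v)

open Classical in
/-- The auxiliary graph `H(G_s, r)`. Self-loops are dropped, and multiple edges become double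
edges. -/
noncomputable def aux [Fintype V] (G : MultiDigraph V) (s r : V) : MultiDigraph V where
  verts := G.tree s r ∪ {z | G.Marked s z ∧ ∃ d ∈ G.tree s r, G.IsIdom s d z} ∪
    {d | r ≠ s ∧ G.IsIdom s d r}
  mult a b := if a = b then 0 else
    min 2 (∑ u : V, ∑ v : V,
      if G.ShrinksTo s r u a ∧ G.ShrinksTo s r v b then G.mult u v else 0)
  left_mem {a b} h := by
    by_contra hn
    have hS : ∀ u, ¬ G.ShrinksTo s r u a := by
      rintro u (⟨h1, rfl⟩ | ⟨h1, h2, -⟩ | ⟨h1, h2, -⟩)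
      · exact hn (Or.inl (Or.inl h1))
      · exact hn (Or.inl (Or.inr ⟨h1, h2⟩))
      · exact hn (Or.inr ⟨h1, h2⟩)
    simp [hS] at h
  right_mem {a b} h := by
    by_contra hn
    have hS : ∀ u, ¬ G.ShrinksTo s r u b := by
      rintro u (⟨h1, rfl⟩ | ⟨h1, h2, -⟩ | ⟨h1, h2, -⟩)
      · exact hn (Or.inl (Or.inl h1))
      · exact hn (Or.inl (Or.inr ⟨h1, h2⟩))
      · exact hn (Or.inr ⟨h1, h2⟩)
    simp [hS] at h

/-- `H_r = H(G_s, r)`. -/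
noncomputable def auxOne [Fintype V] (G : MultiDigraph V) (s r : V) : MultiDigraph V :=
  G.aux s r

/-- `H_{rr'} = H(H_rᴿ, r')`, where `H_rᴿ` is a flow graph with start vertex `r`. -/
noncomputable def auxTwo [Fintype V] (G : MultiDigraph V) (s r r' : V) : MultiDigraph V :=
  (G.auxOne s r).reverse.aux r r'

/-- The `oo`-vertices of `H_{rr'}`: the vertices that are ordinary both in `H_r` (they are in the
tree `T(r)` of `G_s`) and in `H_{rr'}` (they are in the tree `T(r')` of `H_rᴿ`). -/
def oo [Fintype V] (G : MultiDigraph V) (s r r' : V) : Set V :=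
  G.tree s r ∩ (G.auxOne s r).reverse.tree r r'

end FlowGraph

section SOperation

variable {V : Type*} [Fintype V]

open Classical in
/-- The graph `C'` that the `S`-operation on `G` and `(x, y)` makes from a component with vertex
set `C` of `G \ (x, y)`: the edges of `G` inside `C`, an edge `(u, x)` for every edge `(u, w)` that
leaves `C`, an edge `(y, v)` for every edge `(w, v)` that enters `C`, and the edge `(x, y)`. -/
noncomputable def sGraph (G : MultiDigraph V) (x y : V) (C : Set V) : MultiDigraph V where
  verts := C ∪ {x, y}
  mult u v :=
    (if u ∈ C ∧ v ∈ C then G.mult u v else 0) +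
    (if u ∈ C ∧ v = x then ∑ w : V, (if w ∉ C then G.mult u w else 0) else 0) +
    (if u = y ∧ v ∈ C then ∑ w : V, (if w ∉ C then G.mult w v else 0) else 0) +
    (if u = x ∧ v = y then 1 else 0)
  left_mem {u v} h := by
    by_contra hn
    simp only [Set.mem_union, Set.mem_insert_iff, Set.mem_singleton_iff, not_or] at hn
    simp [hn.1, hn.2.1, hn.2.2] at h
  right_mem {u v} h := by
    by_contra hn
    simp only [Set.mem_union, Set.mem_insert_iff, Set.mem_singleton_iff, not_or] at hn
    simp [hn.1, hn.2.1, hn.2.2] at h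

/-- `S(G, (x, y))`. -/
def sOp (G : MultiDigraph V) (x y : V) : Set (MultiDigraph V) :=
  {A | ∃ C : MultiDigraph V, (G.deleteEdge x y).IsSCC C ∧ A = G.sGraph x y C.verts}

end SOperation

end MultiDigraph

/-! The first ingredient describes twinless connectivity by paths (`twinlessConn_iff`): x and y lie
in one TSCC iff each reaches the other and, for all u, v, some path from x to y avoids (u, v) or
some path from y to x avoids (v, u). The hard direction starts from the strong component of x and y
and removes twins step by step. If one of two twins can be deleted without losing strong
connectivity, the path condition survives. Otherwise the twins are the only edges between two sides,
the path condition puts x and y on the same side, and the other side is discarded. The resulting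
form `TwoEdgeLinked` of the 2-edge relation only asks whether multiplicities are 0, 1 or at least 2,
and it is invariant under reversal.

The second ingredient is a contraction lemma, `IsContraction.twoEdgeLinked_iff`. Suppose a set of
vertices splits into fibres, each entered only by one simple edge, whose head is a representative
that reaches the whole fibre. Then contracting the fibres does not change the relation between
vertices outside. Both graph operations are two such contractions, one of them in the reversed
graph. In H(G_s, r), each D(z) is entered only by the bridge (d(z), z), and the complement of D(r)
is left only by (d(r), r) (`twoEdgeLinked_aux`). In the S-operation, the vertices outside a
component C that reach C without (a, b) are entered only by (a, b), and the remaining ones are left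
only by (a, b) (`twoEdgeLinked_sGraph`).

Finally, deleting a bridge (d(z), z) cuts D(z) off from outside, so related vertices lie in one T(r)
(`TwoEdgeLinked.mem_tree`). Applying this to G_s and then to the reverse of H_r makes every related
pair a pair of oo-vertices of a single H_{rr'} (`TwoEdgeTwinlessConn.exists_oo`), and the relation
is the same in G, in H_{rr'} and, for r' ≠ r, across the graphs of the S-operation. -/

open Relation

namespace MultiDigraph

/-! ### Path characterization of twinless strong connectivity. -/

section Links

variable {V : Type*}

/-- The relation `E` without the pair `(a, b)`. -/
def dropEdge (E : V → V → Prop) (a b : V) : V → V → Prop :=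
  fun p q => E p q ∧ ¬ (p = a ∧ q = b)

/-- The vertices `x` and `y` reach each other, and for every pair of twins either there is a path
from `x` to `y` without the first twin or a path from `y` to `x` without the second one. -/
structure TwinlessLinked (E : V → V → Prop) (x y : V) : Prop where
  fwd : ReflTransGen E x y
  bwd : ReflTransGen E y x
  twin : ∀ u v, ReflTransGen (dropEdge E u v) x y ∨ ReflTransGen (dropEdge E v u) y x

theorem _root_.Relation.ReflTransGen.weaken {E F : V → V → Prop} {a b : V}
    (h : ReflTransGen E a b) (hEF : ∀ p q, E p q → F p q) : ReflTransGen F a b :=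
  ReflTransGen.mono hEF _ _ h

theorem dropEdge_mono {E F : V → V → Prop} (h : ∀ p q, E p q → F p q) (a b p q : V)
    (hp : dropEdge E a b p q) : dropEdge F a b p q := ⟨h _ _ hp.1, hp.2⟩

theorem TwinlessLinked.weaken {E F : V → V → Prop} {x y : V} (h : TwinlessLinked E x y)
    (hEF : ∀ p q, E p q → F p q) : TwinlessLinked F x y :=
  ⟨h.fwd.weaken hEF, h.bwd.weaken hEF, fun u v =>
    (h.twin u v).imp (fun h => h.weaken (dropEdge_mono hEF u v))
      fun h => h.weaken (dropEdge_mono hEF v u)⟩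

theorem TwinlessLinked.symm {E : V → V → Prop} {x y : V} (h : TwinlessLinked E x y) :
    TwinlessLinked E y x :=
  ⟨h.bwd, h.fwd, fun u v => (h.twin v u).symm⟩

theorem TwinlessLinked.refl (E : V → V → Prop) (x : V) : TwinlessLinked E x x :=
  ⟨.refl, .refl, fun _ _ => Or.inl .refl⟩

theorem mem_of_reflTransGen {E : V → V → Prop} {S : Set V}
    (hS : ∀ p ∈ S, ∀ q, E p q → q ∈ S) {p q : V} (h : ReflTransGen E p q) (hp : p ∈ S) :
    q ∈ S := by
  induction h with
  | refl => exact hp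
  | tail _ hbc ih => exact hS _ ih _ hbc

theorem exists_exit {E : V → V → Prop} {S : Set V} {p q : V} (h : ReflTransGen E p q)
    (hp : p ∈ S) (hq : q ∉ S) : ∃ u v, E u v ∧ u ∈ S ∧ v ∉ S := by
  by_contra! hn
  exact hq (mem_of_reflTransGen (fun p hp q hpq => hn p q hpq hp) h hp)

theorem reflTransGen_restrict {E : V → V → Prop} {W : Set V} {p q : V}
    (h : ReflTransGen E p q)
    (hW : ∀ m, ReflTransGen E p m → ReflTransGen E m q → m ∈ W) :
    ReflTransGen (fun a b => E a b ∧ a ∈ W ∧ b ∈ W) p q := by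
  induction h using ReflTransGen.head_induction_on with
  | refl => exact .refl
  | head hac hcb ih =>
    exact .head ⟨hac, hW _ .refl (.head hac hcb), hW _ (.single hac) hcb⟩
      (ih fun m hm hm' => hW m (.head hac hm) hm')

/-- `F` is a strongly connected subrelation of `E` on the set `W`, and it links `x` and `y`. -/
structure StrongLink (E : V → V → Prop) (x y : V) (W : Set V) (F : V → V → Prop) : Prop where
  sub : ∀ p q, F p q → E p q
  mem : ∀ p q, F p q → p ∈ W ∧ q ∈ W
  conn : ∀ p ∈ W, ∀ q ∈ W, ReflTransGen F p q
  left : x ∈ W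
  right : y ∈ W
  link : TwinlessLinked F x y

/-- The strong component of `x` works: a path between two of its vertices never leaves it, and this
also holds for the paths that avoid an edge. -/
theorem TwinlessLinked.exists_strongLink {E : V → V → Prop} {x y : V}
    (h : TwinlessLinked E x y) : ∃ W F, StrongLink E x y W F := by
  set W : Set V := {v | ReflTransGen E x v ∧ ReflTransGen E v x}
  have hx : x ∈ W := ⟨.refl, .refl⟩
  have hy : y ∈ W := ⟨h.fwd, h.bwd⟩
  have key : ∀ X : V → V → Prop, (∀ p q, X p q → E p q) → ∀ p ∈ W, ∀ q ∈ W,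
      ReflTransGen X p q → ReflTransGen (fun a b => X a b ∧ a ∈ W ∧ b ∈ W) p q := by
    intro X hX p hp q hq hpq
    exact reflTransGen_restrict hpq fun m h1 h2 =>
      ⟨hp.1.trans (h1.weaken hX), (h2.weaken hX).trans hq.2⟩
  have key' : ∀ u v, ∀ p ∈ W, ∀ q ∈ W, ReflTransGen (dropEdge E u v) p q →
      ReflTransGen (dropEdge (fun a b => E a b ∧ a ∈ W ∧ b ∈ W) u v) p q := by
    intro u v p hp q hq hpq
    refine (key _ (fun _ _ h => h.1) p hp q hq hpq).weaken ?_
    rintro a b ⟨⟨h1, h2⟩, h3⟩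
    exact ⟨⟨h1, h3⟩, h2⟩
  refine ⟨W, fun p q => E p q ∧ p ∈ W ∧ q ∈ W, fun _ _ h => h.1, fun _ _ h => h.2, ?_, hx, hy,
    key _ (fun _ _ h => h) _ hx _ hy h.fwd, key _ (fun _ _ h => h) _ hy _ hx h.bwd, fun u v => ?_⟩
  · exact fun p hp q hq => key _ (fun _ _ h => h) _ hp _ hq (hp.2.trans hq.1)
  · exact (h.twin u v).imp (key' _ _ _ hx _ hy) (key' _ _ _ hy _ hx)

/-- If the relation stays strongly connected without `(u, v)` but keeps `(v, u)`, then it still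
links `x` and `y`. -/
theorem StrongLink.dropEdge_of_conn {E F : V → V → Prop} {x y : V} {W : Set V}
    (h : StrongLink E x y W F) {u v : V} (huv : u ≠ v) (hvu : F v u)
    (hc : ∀ p ∈ W, ∀ q ∈ W, ReflTransGen (dropEdge F u v) p q) :
    StrongLink E x y W (dropEdge F u v) := by
  have hM : dropEdge F u v v u := ⟨hvu, fun h => huv h.2⟩
  refine ⟨fun p q hp => h.sub p q hp.1, fun p q hp => h.mem p q hp.1, hc, h.left, h.right,
    hc _ h.left _ h.right, hc _ h.right _ h.left, fun a b => ?_⟩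
  -- A violated twin condition at `(a, b)` yields sets `S` around `x` and `T` around `y` whose only
  -- exits are `(a, b)` and `(b, a)`. Their intersection is closed under edges, so strong
  -- connectivity makes it empty; together they cover `W`.
  by_contra! hn
  obtain ⟨hS, hT⟩ := hn
  set M := dropEdge F u v
  set S : Set V := {m | ReflTransGen (dropEdge M a b) x m} with hSdef
  set T : Set V := {m | ReflTransGen (dropEdge M b a) y m} with hTdef
  have hxS : x ∈ S := ReflTransGen.refl
  have hyT : y ∈ T := ReflTransGen.refl
  have exS : ∀ p q, M p q → p ∈ S → q ∉ S → p = a ∧ q = b := by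
    intro p q hpq hp hq
    by_contra hne
    exact hq (ReflTransGen.tail hp ⟨hpq, hne⟩)
  have exT : ∀ p q, M p q → p ∈ T → q ∉ T → p = b ∧ q = a := by
    intro p q hpq hp hq
    by_contra hne
    exact hq (ReflTransGen.tail hp ⟨hpq, hne⟩)
  obtain ⟨haS, hbS⟩ : a ∈ S ∧ b ∉ S := by
    obtain ⟨p, q, hpq, hp, hq⟩ := exists_exit (hc _ h.left _ h.right) hxS hS
    obtain ⟨rfl, rfl⟩ := exS p q hpq hp hq
    exact ⟨hp, hq⟩
  obtain ⟨hbT, haT⟩ : b ∈ T ∧ a ∉ T := by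
    obtain ⟨p, q, hpq, hp, hq⟩ := exists_exit (hc _ h.right _ h.left) hyT hT
    obtain ⟨rfl, rfl⟩ := exT p q hpq hp hq
    exact ⟨hp, hq⟩
  have hSW : ∀ m ∈ S, m ∈ W := fun m hm =>
    mem_of_reflTransGen (fun p _ q hpq => (h.mem p q hpq.1.1).2) hm h.left
  have hdisj : ∀ m, m ∈ S → m ∉ T := by
    intro m hmS hmT
    refine hT (mem_of_reflTransGen (S := S ∩ T) ?_ (hc m (hSW m hmS) x h.left) ⟨hmS, hmT⟩).2
    rintro p ⟨hpS, hpT⟩ q hpq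
    refine ⟨?_, ?_⟩
    · by_contra hq
      exact haT ((exS p q hpq hpS hq).1 ▸ hpT)
    · by_contra hq
      exact hbS ((exT p q hpq hpT hq).1 ▸ hpS)
  have hcov : ∀ m ∈ W, m ∈ S ∪ T := by
    intro m hm
    refine mem_of_reflTransGen ?_ (hc x h.left m hm) (Or.inl hxS)
    rintro p (hp | hp) q hpq
    · by_cases hq : q ∈ S
      · exact Or.inl hq
      · exact Or.inr ((exS p q hpq hp hq).2 ▸ hbT)
    · by_cases hq : q ∈ T
      · exact Or.inr hq
      · exact Or.inl ((exT p q hpq hp hq).2 ▸ haS)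
  -- The path that the original relation offers must change sides along the deleted edge `(u, v)`.
  -- The surviving twin `(v, u)` then crosses back, so the twins are `(a, b)` and `(b, a)`
  -- themselves, which that path avoids.
  rcases h.link.twin a b with h1 | h1
  · obtain ⟨p, q, hpq, hp, hq⟩ := exists_exit h1 hxS hS
    have huv' : p = u ∧ q = v := by
      by_contra hne
      exact hpq.2 (exS p q ⟨hpq.1, hne⟩ hp hq)
    obtain ⟨rfl, rfl⟩ := huv'
    have hqT : q ∈ T := (hcov q (h.mem _ _ hpq.1).2).resolve_left hq
    have := exT q p hM hqT (hdisj p hp)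
    exact hpq.2 ⟨this.2, this.1⟩
  · obtain ⟨p, q, hpq, hp, hq⟩ := exists_exit h1 hyT hT
    have huv' : p = u ∧ q = v := by
      by_contra hne
      exact hpq.2 (exT p q ⟨hpq.1, hne⟩ hp hq)
    obtain ⟨rfl, rfl⟩ := huv'
    have hqS : q ∈ S := (hcov q (h.mem _ _ hpq.1).2).resolve_right hq
    have := exS q p hM hqS (fun hpS => hdisj p hpS hp)
    exact hpq.2 ⟨this.2, this.1⟩

/-- If the twins `(u, v)`, `(v, u)` are the only edges between `S` and its complement, then the
restriction to `S` still links `x` and `y`. -/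
theorem StrongLink.restrict {E F : V → V → Prop} {x y : V} {W : Set V}
    (h : StrongLink E x y W F) {u v : V} {S : Set V} (hSW : S ⊆ W)
    (hout : ∀ p q, F p q → p ∈ S → q ∉ S → p = u ∧ q = v)
    (hin : ∀ p q, F p q → p ∉ S → q ∈ S → p = v ∧ q = u) (hx : x ∈ S) (hy : y ∈ S) :
    StrongLink E x y S (fun p q => F p q ∧ p ∈ S ∧ q ∈ S) := by
  have key : ∀ X : V → V → Prop, (∀ p q, X p q → F p q) → ∀ p ∈ S, ∀ q ∈ S,
      ReflTransGen X p q → ReflTransGen (fun a b => X a b ∧ a ∈ S ∧ b ∈ S) p q := by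
    intro X hX p hp q hq hpq
    have : (q ∈ S → ReflTransGen (fun a b => X a b ∧ a ∈ S ∧ b ∈ S) p q) ∧
        (q ∉ S → ReflTransGen (fun a b => X a b ∧ a ∈ S ∧ b ∈ S) p u) := by
      clear hq
      induction hpq with
      | refl => exact ⟨fun _ => .refl, fun h => absurd hp h⟩
      | @tail b c _ hbc ih =>
        by_cases hb : b ∈ S <;> by_cases hc : c ∈ S
        · exact ⟨fun _ => (ih.1 hb).tail ⟨hbc, hb, hc⟩, fun h => absurd hc h⟩
        · refine ⟨fun h => absurd h hc, fun _ => ?_⟩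
          rw [← (hout b c (hX _ _ hbc) hb hc).1]
          exact ih.1 hb
        · refine ⟨fun _ => ?_, fun h => absurd hc h⟩
          rw [(hin b c (hX _ _ hbc) hb hc).2]
          exact ih.2 hb
        · exact ⟨fun h => absurd h hc, fun _ => ih.2 hb⟩
    exact this.1 hq
  have key' : ∀ a b, ∀ p ∈ S, ∀ q ∈ S, ReflTransGen (dropEdge F a b) p q →
      ReflTransGen (dropEdge (fun a b => F a b ∧ a ∈ S ∧ b ∈ S) a b) p q := by
    intro u v p hp q hq hpq
    refine (key _ (fun _ _ h => h.1) p hp q hq hpq).weaken ?_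
    rintro a b ⟨⟨h1, h2⟩, h3⟩
    exact ⟨⟨h1, h3⟩, h2⟩
  have hcon : ∀ p ∈ S, ∀ q ∈ S, ReflTransGen (fun p q => F p q ∧ p ∈ S ∧ q ∈ S) p q :=
    fun p hp q hq => key _ (fun _ _ h => h) _ hp _ hq (h.conn _ (hSW hp) _ (hSW hq))
  exact ⟨fun p q hpq => h.sub _ _ hpq.1, fun _ _ h => h.2, hcon, hx, hy,
    hcon _ hx _ hy, hcon _ hy _ hx, fun a b =>
      (h.link.twin a b).imp (key' _ _ _ hx _ hy) (key' _ _ _ hy _ hx)⟩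

/-- If neither twin can be dropped, the vertices reachable without `(u, v)` and those reachable
without `(v, u)` partition `W`, with the twins as the only edges in between. The twin condition for
this very pair forbids `x` and `y` on different sides, so restricting to their common side loses
vertices. -/
theorem StrongLink.exists_smaller [Finite V] {E F : V → V → Prop} {x y : V} {W : Set V}
    (h : StrongLink E x y W F) {u v : V} (hne : u ≠ v) (huv : F u v) (hvu : F v u) :
    ∃ W' F', StrongLink E x y W' F' ∧
      W'.ncard + {e : V × V | F' e.1 e.2}.ncard < W.ncard + {e : V × V | F e.1 e.2}.ncard := by
  have drop : ∀ u v, F u v → {e : V × V | dropEdge F u v e.1 e.2}.ncard <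
      {e : V × V | F e.1 e.2}.ncard := by
    intro u v huv
    refine Set.ncard_lt_ncard ⟨fun e he => he.1, fun hs => ?_⟩ (Set.toFinite _)
    exact (hs (show (u, v) ∈ {e : V × V | F e.1 e.2} from huv)).2 ⟨rfl, rfl⟩
  have restr : ∀ S : Set V, S ⊆ W → (∃ w ∈ W, w ∉ S) →
      S.ncard + {e : V × V | F e.1 e.2 ∧ e.1 ∈ S ∧ e.2 ∈ S}.ncard <
        W.ncard + {e : V × V | F e.1 e.2}.ncard := by
    rintro S hS ⟨w, hw, hwS⟩
    refine add_lt_add_of_lt_of_le (Set.ncard_lt_ncard ⟨hS, fun h => hwS (h hw)⟩ (Set.toFinite _))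
      (Set.ncard_le_ncard (fun e he => he.1) (Set.toFinite _))
  by_cases h1 : ∀ p ∈ W, ∀ q ∈ W, ReflTransGen (dropEdge F u v) p q
  · exact ⟨_, _, h.dropEdge_of_conn hne hvu h1, by have := drop u v huv; omega⟩
  by_cases h2 : ∀ p ∈ W, ∀ q ∈ W, ReflTransGen (dropEdge F v u) p q
  · exact ⟨_, _, h.dropEdge_of_conn hne.symm huv h2, by have := drop v u hvu; omega⟩
  push Not at h1 h2
  have side : ∀ u v, (∃ p ∈ W, ∃ q ∈ W, ¬ ReflTransGen (dropEdge F u v) p q) →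
      ∃ S : Set V, S ⊆ W ∧ u ∈ S ∧ v ∉ S ∧ ∀ p q, F p q → p ∈ S → q ∉ S → p = u ∧ q = v := by
    rintro u v ⟨p, hp, q, hq, hpq⟩
    have ex : ∀ c d, F c d → ReflTransGen (dropEdge F u v) p c →
        ¬ ReflTransGen (dropEdge F u v) p d → c = u ∧ d = v := by
      intro c d hcd hc hd
      by_contra hne
      exact hd (hc.tail ⟨hcd, hne⟩)
    obtain ⟨c, d, hcd, hc, hd⟩ :=
      exists_exit (S := {m | ReflTransGen (dropEdge F u v) p m}) (h.conn p hp q hq) .refl hpq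
    obtain ⟨rfl, rfl⟩ := ex c d hcd hc hd
    exact ⟨_, fun m hm => mem_of_reflTransGen (fun p _ q hpq => (h.mem p q hpq.1).2) hm hp,
      hc, hd, ex⟩
  obtain ⟨S, hSW, huS, hvS, exS⟩ := side u v h1
  obtain ⟨T, hTW, hvT, huT, exT⟩ := side v u h2
  have hdisj : ∀ m, m ∈ S → m ∉ T := by
    intro m hmS hmT
    refine hvS (mem_of_reflTransGen (S := S ∩ T) ?_
      (h.conn m (hSW hmS) v (h.mem _ _ huv).2) ⟨hmS, hmT⟩).1
    rintro p ⟨hpS, hpT⟩ q hpq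
    refine ⟨?_, ?_⟩
    · by_contra hq
      exact huT ((exS p q hpq hpS hq).1 ▸ hpT)
    · by_contra hq
      exact hvS ((exT p q hpq hpT hq).1 ▸ hpS)
  have hcov : ∀ m ∈ W, m ∈ S ∪ T := by
    intro m hm
    refine mem_of_reflTransGen ?_ (h.conn u (hSW huS) m hm) (Or.inl huS)
    rintro p (hp | hp) q hpq
    · by_cases hq : q ∈ S
      · exact Or.inl hq
      · exact Or.inr ((exS p q hpq hp hq).2 ▸ hvT)
    · by_cases hq : q ∈ T
      · exact Or.inr hq
      · exact Or.inl ((exT p q hpq hp hq).2 ▸ huS)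
  have notT : ∀ m, m ∈ T → m ∉ S := fun m hT hS => hdisj m hS hT
  have stay : ∀ (a b : V) (R : Set V), (∀ p q, F p q → p ∈ R → q ∉ R → p = a ∧ q = b) →
      ∀ p q, ReflTransGen (dropEdge F a b) p q → p ∈ R → q ∈ R := by
    intro a b R hR p q hpq
    refine fun hp => mem_of_reflTransGen (fun c hc d hcd => ?_) hpq hp
    by_contra hd
    exact hcd.2 (hR c d hcd.1 hc hd)
  rcases hcov x h.left with hx | hx <;> rcases hcov y h.right with hy | hy
  · refine ⟨S, _, h.restrict hSW exS (v := v) (fun p q hpq hp hq => ?_) hx hy,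
      restr S hSW ⟨v, hTW hvT, hvS⟩⟩
    exact exT p q hpq ((hcov p (h.mem _ _ hpq).1).resolve_left hp) (hdisj q hq)
  · rcases h.link.twin u v with h3 | h3
    · exact absurd hy (hdisj y (stay u v S exS _ _ h3 hx))
    · exact absurd (stay v u T exT _ _ h3 hy) (hdisj x hx)
  · rcases h.link.twin v u with h3 | h3
    · exact absurd (stay v u T exT _ _ h3 hx) (hdisj y hy)
    · exact absurd hx (hdisj x (stay u v S exS _ _ h3 hy))
  · refine ⟨T, _, h.restrict hTW exT (v := u) (fun p q hpq hp hq => ?_) hx hy,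
      restr T hTW ⟨u, hSW huS, huT⟩⟩
    exact exS p q hpq ((hcov p (h.mem _ _ hpq).1).resolve_right hp) (notT q hq)

theorem StrongLink.exists_noTwins [Finite V] {E : V → V → Prop} {x y : V} {W : Set V}
    {F : V → V → Prop} (h : StrongLink E x y W F) :
    ∃ W F, StrongLink E x y W F ∧ ∀ u v, u ≠ v → ¬ (F u v ∧ F v u) := by
  induction hn : W.ncard + {e : V × V | F e.1 e.2}.ncard using Nat.strong_induction_on
    generalizing W F with
  | _ n ih =>
    by_cases ht : ∀ u v, u ≠ v → ¬ (F u v ∧ F v u)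
    · exact ⟨W, F, h, ht⟩
    · push Not at ht
      obtain ⟨u, v, hne, huv, hvu⟩ := ht
      obtain ⟨W', F', h', hlt⟩ := h.exists_smaller hne huv hvu
      exact ih _ (hn ▸ hlt) h' rfl

/-- The adjacency relation of a multidigraph. -/
def Adj (G : MultiDigraph V) (u v : V) : Prop := 0 < G.mult u v

theorem Reaches.iff_reflTransGen {G : MultiDigraph V} {u v : V} :
    G.Reaches u v ↔ u ∈ G.verts ∧ ReflTransGen G.Adj u v := by
  constructor
  · rintro ⟨l, hl⟩
    induction hl with
    | single hv => exact ⟨hv, .refl⟩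
    | cons h _ ih => exact ⟨G.left_mem h, .head h ih.2⟩
  · rintro ⟨hu, h⟩
    induction h using ReflTransGen.head_induction_on with
    | refl => exact ⟨_, .single hu⟩
    | head h _ ih =>
      obtain ⟨l, hl⟩ := ih (G.right_mem h)
      exact ⟨_, .cons h hl⟩

theorem StronglyConnected.reach {G : MultiDigraph V} (hG : G.StronglyConnected) {u v : V}
    (hu : u ∈ G.verts) (hv : v ∈ G.verts) : ReflTransGen G.Adj u v :=
  (Reaches.iff_reflTransGen.1 (hG u hu v hv)).2

theorem mem_verts_of_reach {G : MultiDigraph V} {u v : V} (hu : u ∈ G.verts)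
    (h : ReflTransGen G.Adj u v) : v ∈ G.verts :=
  mem_of_reflTransGen (fun _ _ _ h => G.right_mem h) h hu

/-- Below a multidigraph with finitely many vertices, every subgraph with some property lies in a
maximal one. -/
theorem exists_le_maximal [Finite V] (G : MultiDigraph V) (p : MultiDigraph V → Prop)
    {H : MultiDigraph V} (hH : H ≤ G ∧ p H) :
    ∃ C, H ≤ C ∧ Maximal (fun H : MultiDigraph V => H ≤ G ∧ p H) C := by
  have := Fintype.ofFinite V
  let m : MultiDigraph V → ℕ := fun H => H.verts.ncard + ∑ u, ∑ v, H.mult u v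
  have trans : ∀ {A B C : MultiDigraph V}, A ≤ B → B ≤ C → A ≤ C := fun h1 h2 =>
    ⟨h1.1.trans h2.1, fun u v => (h1.2 u v).trans (h2.2 u v)⟩
  have mono : ∀ {A B : MultiDigraph V}, A ≤ B → m A ≤ m B := fun h =>
    add_le_add (Set.ncard_le_ncard h.1 (Set.toFinite _))
      (Finset.sum_le_sum fun u _ => Finset.sum_le_sum fun v _ => h.2 u v)
  have key : ∀ {A B : MultiDigraph V}, A ≤ B → m B ≤ m A → B ≤ A := by
    intro A B h hm
    have h1 := Set.ncard_le_ncard h.1 (Set.toFinite _)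
    have hs : ∀ u, ∑ v, A.mult u v ≤ ∑ v, B.mult u v := fun u =>
      Finset.sum_le_sum fun v _ => h.2 u v
    have h2 : ∑ u, ∑ v, A.mult u v ≤ ∑ u, ∑ v, B.mult u v :=
      Finset.sum_le_sum fun u _ => hs u
    have h3 : m A = A.verts.ncard + ∑ u, ∑ v, A.mult u v := rfl
    have h4 : m B = B.verts.ncard + ∑ u, ∑ v, B.mult u v := rfl
    refine ⟨(Set.eq_of_subset_of_ncard_le h.1 (by omega) (Set.toFinite _)).symm.subset,
      fun u v => ?_⟩
    have h5 := (Finset.sum_eq_sum_iff_of_le fun u _ => hs u).1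
      (show ∑ u, ∑ v, A.mult u v = ∑ u, ∑ v, B.mult u v by omega) u (Finset.mem_univ _)
    exact ((Finset.sum_eq_sum_iff_of_le fun v _ => h.2 u v).1 h5 v (Finset.mem_univ _)).ge
  have hb : ∀ n, (∃ C, H ≤ C ∧ (C ≤ G ∧ p C) ∧ m C = n) → n ≤ m G := by
    rintro n ⟨C, _, h, rfl⟩
    exact mono h.1
  classical
  have hex : ∃ n, ∃ C, H ≤ C ∧ (C ≤ G ∧ p C) ∧ m C = n :=
    ⟨_, H, ⟨subset_rfl, fun _ _ => le_rfl⟩, hH, rfl⟩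
  obtain ⟨n0, hn0⟩ := hex
  obtain ⟨C, hHC, hC, hm⟩ := Nat.findGreatest_spec
    (P := fun n => ∃ C, H ≤ C ∧ (C ≤ G ∧ p C) ∧ m C = n) (hb n0 hn0) hn0
  refine ⟨C, hHC, hC, fun D hD hCD => key hCD ?_⟩
  rw [hm]
  exact Nat.le_findGreatest (mono hD.1) ⟨D, trans hHC hCD, hD, rfl⟩

/-- A twin-free subgraph lacks `(u, v)` or `(v, u)`, so one direction of travel is unaffected.
Conversely, a twin-free strong link becomes a subgraph with simple edges, which extends to a maximal
one. -/
theorem twinlessConn_iff [Finite V] {G : MultiDigraph V} {x y : V} :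
    G.TwinlessConn x y ↔ x ∈ G.verts ∧ y ∈ G.verts ∧ TwinlessLinked G.Adj x y := by
  constructor
  · rintro ⟨C, ⟨⟨hCG, K, hKC, hK, hKs, hKt⟩, -⟩, hx, hy⟩
    have hadj : ∀ p q, K.Adj p q → G.Adj p q := fun p q (h : 0 < _) =>
      show 0 < _ from h.trans_le ((hKC.2 p q).trans (hCG.2 p q))
    rw [← hK] at hx hy
    refine ⟨hCG.1 (hKC.1 hx), hCG.1 (hKC.1 hy), TwinlessLinked.weaken ?_ hadj⟩
    refine ⟨hKs.reach hx hy, hKs.reach hy hx, fun u v => ?_⟩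
    -- `NoTwins` says nothing about loops, but a loop can be cut out of any path.
    rcases eq_or_ne u v with rfl | hne
    · left
      have : ∀ {p q}, ReflTransGen K.Adj p q → ReflTransGen (dropEdge K.Adj u u) p q := by
        intro p q h
        induction h with
        | refl => exact .refl
        | @tail b c _ hbc ih =>
          by_cases h : b = u ∧ c = u
          · rw [h.2]; rwa [h.1] at ih
          · exact ih.tail ⟨hbc, h⟩
      exact this (hKs.reach hx hy)
    · by_cases huv : K.Adj u v
      · right
        refine (hKs.reach hy hx).weaken fun p q hpq => ⟨hpq, ?_⟩
        rintro ⟨rfl, rfl⟩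
        exact hKt _ _ hne ⟨huv, hpq⟩
      · left
        refine (hKs.reach hx hy).weaken fun p q hpq => ⟨hpq, ?_⟩
        rintro ⟨rfl, rfl⟩
        exact huv hpq
  · rintro ⟨hx, hy, h⟩
    obtain ⟨W, F, h⟩ := h.exists_strongLink
    obtain ⟨W, F, h, ht⟩ := h.exists_noTwins
    classical
    let K : MultiDigraph V :=
      { verts := W
        mult := fun u v => if F u v then 1 else 0
        left_mem := fun {u v} huv => (h.mem u v (by by_contra hn; simp [hn] at huv)).1
        right_mem := fun {u v} huv => (h.mem u v (by by_contra hn; simp [hn] at huv)).2 }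
    have hadj : ∀ u v, K.Adj u v ↔ F u v := by
      intro u v
      by_cases hF : F u v <;> simp [Adj, K, hF]
    have hKG : K ≤ G := by
      refine ⟨fun w hw => ?_, fun u v => ?_⟩
      · exact mem_verts_of_reach hx ((h.conn x h.left w hw).weaken h.sub)
      · show (if F u v then 1 else 0) ≤ _
        split_ifs with hF
        · exact h.sub u v hF
        · exact Nat.zero_le _
    have hKs : K.TwinlessStronglyConnected := by
      refine ⟨K, ⟨subset_rfl, fun _ _ => le_rfl⟩, rfl, fun u hu v hv => ?_, fun u v hne huv => ?_⟩
      · exact Reaches.iff_reflTransGen.2 ⟨hu, (h.conn u hu v hv).weaken fun p q => (hadj p q).2⟩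
      · exact ht u v hne ⟨(hadj _ _).1 huv.1, (hadj _ _).1 huv.2⟩
    obtain ⟨C, hKC, hC⟩ := exists_le_maximal G TwinlessStronglyConnected ⟨hKG, hKs⟩
    exact ⟨C, hC, hKC.1 h.left, hKC.1 h.right⟩

/-- The form that `TwoEdgeTwinlessConn` takes for the multiplicities `w`. -/
def TwoEdgeLinked (w : V → V → ℕ) (x y : V) : Prop :=
  TwinlessLinked (fun u v => 0 < w u v) x y ∧
    ∀ p q, w p q ≤ 1 → TwinlessLinked (dropEdge (fun u v => 0 < w u v) p q) x y

theorem TwoEdgeLinked.swap {w : V → V → ℕ} {x y : V} (h : TwoEdgeLinked w x y) :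
    TwoEdgeLinked (fun u v => w v u) x y := by
  have key : ∀ E : V → V → Prop, TwinlessLinked E x y → TwinlessLinked (fun u v => E v u) x y := by
    intro E h
    have sw : ∀ F : V → V → Prop, ∀ p q, ReflTransGen F p q →
      ReflTransGen (fun u v => F v u) q p := fun F p q h => h.swap
    have sw' : ∀ u v p q, ReflTransGen (dropEdge E u v) p q →
        ReflTransGen (dropEdge (fun u v => E v u) v u) q p := fun u v p q h =>
      (sw _ _ _ h).weaken fun a b hab => ⟨hab.1, fun hn => hab.2 ⟨hn.2, hn.1⟩⟩
    exact ⟨sw _ _ _ h.bwd, sw _ _ _ h.fwd, fun u v =>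
      (h.twin u v).symm.imp (sw' _ _ _ _) (sw' _ _ _ _)⟩
  refine ⟨key _ h.1, fun p q hpq => (key _ (h.2 q p hpq)).weaken fun a b hab => ?_⟩
  exact ⟨hab.1, fun hn => hab.2 ⟨hn.2, hn.1⟩⟩

theorem twoEdgeLinked_swap {w : V → V → ℕ} {x y : V} :
    TwoEdgeLinked (fun u v => w v u) x y ↔ TwoEdgeLinked w x y :=
  ⟨TwoEdgeLinked.swap, TwoEdgeLinked.swap⟩

theorem TwoEdgeLinked.refl (w : V → V → ℕ) (x : V) : TwoEdgeLinked w x x :=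
  ⟨.refl _ _, fun _ _ _ => .refl _ _⟩

theorem adj_deleteEdge (G : MultiDigraph V) {a b p q : V} :
    (G.deleteEdge a b).Adj p q ↔ G.Adj p q ∧ (p = a ∧ q = b → 2 ≤ G.mult p q) := by
  simp only [Adj, deleteEdge]
  split_ifs with h
  · simp only [h, and_self, true_imp_iff]; omega
  · simp [h]

theorem adj_deleteEdge_of_le_one (G : MultiDigraph V) {a b : V} (h : G.mult a b ≤ 1) :
    (G.deleteEdge a b).Adj = dropEdge G.Adj a b := by
  ext p q
  rw [adj_deleteEdge]
  refine and_congr_right fun _ => ⟨?_, fun hn hpq => absurd hpq hn⟩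
  rintro h1 ⟨rfl, rfl⟩
  have := h1 ⟨rfl, rfl⟩
  omega

/-- The set `{x, y}` already has the property that the components maximize, and by finiteness it
extends to a maximal set. -/
theorem twoEdgeTwinlessConn_iff_forall [Finite V] {G : MultiDigraph V} {x y : V} :
    G.TwoEdgeTwinlessConn x y ↔ x ∈ G.verts ∧ y ∈ G.verts ∧
      ∀ a b, 0 < G.mult a b → TwinlessLinked (G.deleteEdge a b).Adj x y := by
  constructor
  · rintro ⟨C, ⟨⟨hCG, hC⟩, -⟩, hx, hy⟩
    exact ⟨hCG hx, hCG hy, fun a b hab => (twinlessConn_iff.1 (hC x hx y hy a b hab)).2.2⟩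
  · rintro ⟨hx, hy, h⟩
    have h0 : (fun D : Set V => D ⊆ G.verts ∧ ∀ u ∈ D, ∀ v ∈ D,
        ∀ a b, 0 < G.mult a b → (G.deleteEdge a b).TwinlessConn u v) {x, y} := by
      refine ⟨by rintro z (rfl | rfl) <;> assumption, ?_⟩
      rintro u (rfl | rfl) v (rfl | rfl) a b hab
      · exact twinlessConn_iff.2 ⟨hx, hx, .refl _ _⟩
      · exact twinlessConn_iff.2 ⟨hx, hy, h a b hab⟩
      · exact twinlessConn_iff.2 ⟨hy, hx, (h a b hab).symm⟩
      · exact twinlessConn_iff.2 ⟨hy, hy, .refl _ _⟩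
    obtain ⟨C, hle, hC⟩ := (Set.toFinite {D : Set V | D ⊆ G.verts ∧ ∀ u ∈ D, ∀ v ∈ D,
        ∀ a b, 0 < G.mult a b → (G.deleteEdge a b).TwinlessConn u v}).exists_le_maximal h0
    exact ⟨C, hC, hle (by simp), hle (by simp)⟩

/-- Without edges the condition on deleted edges is vacuous and relates all vertices, although
distinct ones are not linked; `hE` excludes this case. -/
theorem twoEdgeTwinlessConn_iff [Finite V] {G : MultiDigraph V} {x y : V} (hx : x ∈ G.verts)
    (hy : y ∈ G.verts) (hE : x ≠ y → ∃ a b, 0 < G.mult a b) :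
    G.TwoEdgeTwinlessConn x y ↔ TwoEdgeLinked G.mult x y := by
  rw [twoEdgeTwinlessConn_iff_forall]
  rcases eq_or_ne x y with rfl | hne
  · exact ⟨fun _ => .refl _ _, fun _ => ⟨hx, hx, fun _ _ _ => .refl _ _⟩⟩
  constructor
  · rintro ⟨-, -, h⟩
    have h0 : TwinlessLinked G.Adj x y := by
      obtain ⟨a, b, hab⟩ := hE hne
      exact (h a b hab).weaken fun p q hpq => ((adj_deleteEdge G).1 hpq).1
    refine ⟨h0, fun p q hpq => ?_⟩
    rcases Nat.eq_zero_or_pos (G.mult p q) with h1 | h1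
    · refine h0.weaken fun a b hab => ⟨hab, ?_⟩
      rintro ⟨rfl, rfl⟩
      exact absurd h1 (Nat.pos_iff_ne_zero.1 hab)
    · have := h p q h1
      rwa [adj_deleteEdge_of_le_one G hpq] at this
  · rintro ⟨h0, h⟩
    refine ⟨hx, hy, fun a b hab => ?_⟩
    rcases Nat.lt_or_ge 1 (G.mult a b) with h1 | h1
    · refine h0.weaken fun p q hpq => (adj_deleteEdge G).2 ⟨hpq, ?_⟩
      rintro ⟨rfl, rfl⟩
      exact h1
    · rw [adj_deleteEdge_of_le_one G h1]
      exact h a b h1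

theorem StronglyConnected.twoEdgeTwinlessConn_iff [Finite V] {G : MultiDigraph V}
    (hG : G.StronglyConnected) {x y : V} (hx : x ∈ G.verts) (hy : y ∈ G.verts) :
    G.TwoEdgeTwinlessConn x y ↔ TwoEdgeLinked G.mult x y := by
  refine MultiDigraph.twoEdgeTwinlessConn_iff hx hy fun hne => ?_
  rcases (hG.reach hx hy).cases_head with h | ⟨c, hc, -⟩
  · exact absurd h hne
  · exact ⟨_, _, hc⟩

end Links

end MultiDigraph

namespace MultiDigraph

/-! ### Contracting fibres that are entered by a single edge. -/

section Contraction

variable {V : Type*}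

theorem reflTransGen_dropEdge_or {E : V → V → Prop} {x y : V} (u v : V)
    (h : ReflTransGen E x y) :
    ReflTransGen (dropEdge E u v) x y ∨
      ReflTransGen (dropEdge E u v) x u ∧ ReflTransGen (dropEdge E u v) v y := by
  refine or_iff_not_imp_left.2 fun hn => ⟨?_, ?_⟩
  · obtain ⟨c, d, hcd, hc, hd⟩ :=
      exists_exit (S := {m | ReflTransGen (dropEdge E u v) x m}) h .refl hn
    by_cases he : c = u ∧ d = v
    · exact he.1 ▸ hc
    · exact absurd (ReflTransGen.tail hc ⟨hcd, he⟩) hd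
  · obtain ⟨c, d, hcd, hc, hd⟩ :=
      exists_exit (S := {m | ¬ ReflTransGen (dropEdge E u v) m y}) h hn (not_not.2 .refl)
    have hd := not_not.1 hd
    by_cases he : c = u ∧ d = v
    · exact he.2 ▸ hd
    · exact absurd (ReflTransGen.head ⟨hcd, he⟩ hd) hc

/-- The first vertex among `u`, `v` on a path is reached without edges between `u` and `v`. -/
theorem reflTransGen_first {E : V → V → Prop} {z u : V} (v : V) (h : ReflTransGen E z u) :
    ReflTransGen (dropEdge (dropEdge E u v) v u) z u ∨
      ReflTransGen (dropEdge (dropEdge E u v) v u) z v := by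
  induction h using ReflTransGen.head_induction_on with
  | refl => exact Or.inl .refl
  | @head b c hbc _ ih =>
    rcases eq_or_ne b u with rfl | hbu
    · exact Or.inl .refl
    rcases eq_or_ne b v with rfl | hbv
    · exact Or.inr .refl
    have hs : dropEdge (dropEdge E u v) v u b c := ⟨⟨hbc, fun h => hbu h.1⟩, fun h => hbv h.1⟩
    exact ih.imp (.head hs) (.head hs)

/-- The set `U` is partitioned into fibres with representatives `ρ v`; the fibre with
representative `z` can be entered only by an edge from `α z` to `z`. -/
structure Fibered (F : V → V → Prop) (U : Set V) (ρ α : V → V) : Prop where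
  entry : ∀ u v, u ∉ U → v ∈ U → F u v → v = ρ v ∧ u = α v
  inside : ∀ u v, u ∈ U → v ∈ U → F u v → ρ u = ρ v

namespace Fibered

variable {F : V → V → Prop} {U : Set V} {ρ α : V → V}

theorem mono {F' : V → V → Prop} (h : Fibered F U ρ α) (hF : ∀ p q, F' p q → F p q) :
    Fibered F' U ρ α :=
  ⟨fun u v hu hv huv => h.entry u v hu hv (hF _ _ huv),
    fun u v hu hv huv => h.inside u v hu hv (hF _ _ huv)⟩

theorem pass (h : Fibered F U ρ α) {x m : V} (hx : x ∉ U) (hm : m ∈ U)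
    (hxm : ReflTransGen F x m) : ReflTransGen F x (ρ m) ∧ ReflTransGen F (ρ m) m := by
  induction hxm with
  | refl => exact absurd hm hx
  | @tail b c hxb hbc ih =>
    by_cases hb : b ∈ U
    · rw [← h.inside b c hb hm hbc]
      exact ⟨(ih hb).1, (ih hb).2.tail hbc⟩
    · rw [← (h.entry b c hb hm hbc).1]
      exact ⟨hxb.tail hbc, .refl⟩

/-- A path from outside that uses the edge from `u` back to the tail of the entry edge of its fibre
has visited that tail before entering, so the detour can be cut. -/
theorem dropEdge_back (h : Fibered F U ρ α) {x y u : V} (hx : x ∉ U) (hu : u ∈ U)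
    (hα : α (ρ u) ∉ U) (hxy : ReflTransGen F x y) :
    ReflTransGen (dropEdge F u (α (ρ u))) x y := by
  suffices ReflTransGen (dropEdge F u (α (ρ u))) x y ∧
      (y ∈ U → ρ y = ρ u → ReflTransGen (dropEdge F u (α (ρ u))) x (α (ρ u))) from this.1
  induction hxy with
  | refl => exact ⟨.refl, fun h => absurd h hx⟩
  | @tail b c _ hbc ih =>
    by_cases he : b = u ∧ c = α (ρ u)
    · obtain ⟨rfl, rfl⟩ := he
      exact ⟨ih.2 hu rfl, fun h => absurd h hα⟩
    · refine ⟨ih.1.tail ⟨hbc, he⟩, fun hc hcu => ?_⟩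
      by_cases hb : b ∈ U
      · exact ih.2 hb ((h.inside b c hb hc hbc).trans hcu)
      · obtain ⟨h1, h2⟩ := h.entry b c hb hc hbc
        have hbα : b = α (ρ u) := by rw [← hcu, ← h1]; exact h2
        have := ih.1
        rwa [hbα] at this

theorem twin_of_mem_of_notMem (h : Fibered F U ρ α) {x y u v : V} (hx : x ∉ U)
    (hu : u ∈ U) (hv : v ∉ U) (hxy : ReflTransGen F x y) (hyx : ReflTransGen F y x) :
    ReflTransGen (dropEdge F u v) x y ∨ ReflTransGen (dropEdge F v u) y x := by
  by_cases hα : v = α (ρ u)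
  · subst hα
    exact Or.inl (h.dropEdge_back hx hu hv hxy)
  · refine Or.inr (hyx.weaken fun p q hpq => ⟨hpq, ?_⟩)
    rintro ⟨rfl, rfl⟩
    obtain ⟨h1, h2⟩ := h.entry p q hv hu hpq
    rw [← h1] at hα
    exact hα h2

/-- Pairs of twins that touch the fibres do not separate vertices outside of them. -/
theorem twin (h : Fibered F U ρ α) {x y u v : V} (hx : x ∉ U) (hy : y ∉ U)
    (huv : u ∈ U ∨ v ∈ U) (hxy : ReflTransGen F x y) (hyx : ReflTransGen F y x) :
    ReflTransGen (dropEdge F u v) x y ∨ ReflTransGen (dropEdge F v u) y x := by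
  by_cases hu : u ∈ U <;> by_cases hv : v ∈ U
  · by_cases hne : ρ u = ρ v
    · rcases reflTransGen_dropEdge_or u v hxy with h1 | ⟨h1, h2⟩
      · exact Or.inl h1
      rcases reflTransGen_dropEdge_or v u hyx with h3 | ⟨h3, h4⟩
      · exact Or.inr h3
      -- Both vertices lie in one fibre, so the paths from `x` and from `y` pass through its
      -- representative. From there, whichever of `u`, `v` comes first is reached without either
      -- twin, and this repairs one of the two directions.
      obtain ⟨h5, h6⟩ := (h.mono fun _ _ h => h.1).pass hx hu h1
      obtain ⟨h7, -⟩ := (h.mono fun _ _ h => h.1).pass hy hv h3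
      rcases reflTransGen_first v (h6.weaken fun p q h => h.1) with h8 | h8
      · right
        rw [← hne] at h7
        exact (h7.trans (h8.weaken fun p q h => ⟨h.1.1, h.2⟩)).trans h4
      · left
        exact (h5.trans (h8.weaken fun p q h => h.1)).trans h2
    · refine Or.inl (hxy.weaken fun p q hpq => ⟨hpq, ?_⟩)
      rintro ⟨rfl, rfl⟩
      exact hne (h.inside _ _ hu hv hpq)
  · exact h.twin_of_mem_of_notMem hx hu hv hxy hyx
  · exact (h.twin_of_mem_of_notMem hy hv hu hyx hxy).symm
  · exact absurd huv (by tauto)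

end Fibered

/-- The multiplicities `w'` are obtained from `w` by contracting the fibres of `U` into their
representatives, where the fibre of `z` is entered by a single edge `(α z, z)`. Edges from `z` back
to `α z` may or may not be kept. -/
structure IsContraction (w w' : V → V → ℕ) (U : Set V) (ρ α : V → V) : Prop where
  rep_mem : ∀ v ∈ U, ρ v ∈ U
  rep_rep : ∀ v ∈ U, ρ (ρ v) = ρ v
  tail_notMem : ∀ v ∈ U, α (ρ v) ∉ U
  entry : ∀ u v, u ∉ U → v ∈ U → 0 < w u v → w u v = 1 ∧ v = ρ v ∧ u = α v
  inside : ∀ u v, u ∈ U → v ∈ U → 0 < w u v → ρ u = ρ v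
  reach : ∀ v ∈ U, ReflTransGen (fun p q => 0 < w p q ∧ p ∈ U ∧ q ∈ U) (ρ v) v
  -- Only the distinction between 0, 1 and at least 2 matters, and loops are irrelevant; this
  -- tolerates the truncation to double edges and the removal of loops.
  agree : ∀ u v, u ∉ U → u ≠ v → min 2 (w u v) = min 2 (w' u v)
  inside' : ∀ u v, u ∈ U → v ∈ U → u ≠ v → w' u v = 0
  exit : ∀ u v, u ∈ U → v ∉ U → 0 < w' u v → u = ρ u ∧ ∃ u' ∈ U, ρ u' = u ∧ 0 < w u' v
  exit' : ∀ u v, u ∈ U → v ∉ U → 0 < w u v → v ≠ α (ρ u) → 0 < w' (ρ u) v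

namespace IsContraction

variable {w w' : V → V → ℕ} {U : Set V} {ρ α : V → V}

theorem pos_iff (h : IsContraction w w' U ρ α) {u v : V} (hu : u ∉ U) (hne : u ≠ v) :
    0 < w u v ↔ 0 < w' u v := by
  have := h.agree u v hu hne
  omega

theorem entry' (h : IsContraction w w' U ρ α) {u v : V} (hu : u ∉ U) (hv : v ∈ U)
    (huv : 0 < w' u v) : v = ρ v ∧ u = α v :=
  (h.entry u v hu hv ((h.pos_iff hu (by rintro rfl; exact hu hv)).2 huv)).2

theorem fibered (h : IsContraction w w' U ρ α) : Fibered (fun p q => 0 < w p q) U ρ α :=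
  ⟨fun u v hu hv huv => (h.entry u v hu hv huv).2, h.inside⟩

theorem fibered' (h : IsContraction w w' U ρ α) : Fibered (fun p q => 0 < w' p q) U ρ α := by
  refine ⟨fun u v hu hv huv => h.entry' hu hv huv, fun u v hu hv huv => ?_⟩
  by_contra hne
  have := h.inside' u v hu hv (by rintro rfl; exact hne rfl)
  omega

/-- `Y` and `Y'` are the deleted edges before and after contraction. A deleted edge with its tail in
a fibre is charged to the entry edge of that fibre: once the entry edge is deleted, a path from
outside cannot use the fibre at all. -/
theorem lift (h : IsContraction w w' U ρ α) {Y Y' : V → V → Prop}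
    (h1 : ∀ u v, u ∉ U → u ≠ v → Y u v → Y' u v)
    (h2 : ∀ u v, u ∈ U → u ≠ v → Y u v → Y' (α (ρ u)) (ρ u)) {x y : V} (hx : x ∉ U)
    (hxy : ReflTransGen (fun p q => 0 < w' p q ∧ ¬ Y' p q) x y) :
    ReflTransGen (fun p q => 0 < w p q ∧ ¬ Y p q) x y := by
  have fib : ∀ m k, m = ρ m → ¬ Y' (α m) m → m ∈ U →
      ReflTransGen (fun p q => 0 < w p q ∧ p ∈ U ∧ q ∈ U) m k →
      k ∈ U ∧ ρ k = m ∧ ReflTransGen (fun p q => 0 < w p q ∧ ¬ Y p q) m k := by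
    intro m k hm hY hmU hmk
    induction hmk with
    | refl => exact ⟨hmU, hm.symm, .refl⟩
    | @tail b c _ hbc ih =>
      rcases eq_or_ne b c with rfl | hne
      · exact ih
      refine ⟨hbc.2.2, (h.inside b c hbc.2.1 hbc.2.2 hbc.1).symm.trans ih.2.1,
        ih.2.2.tail ⟨hbc.1, fun hn => hY ?_⟩⟩
      have := h2 b c hbc.2.1 hne hn
      rwa [ih.2.1] at this
  suffices ReflTransGen (fun p q => 0 < w p q ∧ ¬ Y p q) x y ∧
      (y ∈ U → y = ρ y ∧ ¬ Y' (α y) y) from this.1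
  induction hxy with
  | refl => exact ⟨.refl, fun h => absurd h hx⟩
  | @tail b c _ hbc ih =>
    rcases eq_or_ne b c with rfl | hne
    · exact ih
    by_cases hb : b ∈ U
    · obtain ⟨hb1, hb2⟩ := ih.2 hb
      by_cases hc : c ∈ U
      · have := h.inside' b c hb hc hne
        omega
      · refine ⟨?_, fun h => absurd h hc⟩
        obtain ⟨-, b', hb', hbb', hbc'⟩ := h.exit b c hb hc hbc.1
        have hr := h.reach b' hb'
        rw [hbb'] at hr
        refine (ih.1.trans (fib b b' hb1 hb2 hb hr).2.2).tail ⟨hbc', fun hn => hb2 ?_⟩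
        have := h2 b' c hb' (by rintro rfl; exact hc hb') hn
        rwa [hbb'] at this
    · refine ⟨ih.1.tail ⟨(h.pos_iff hb hne).2 hbc.1, fun hn => hbc.2 (h1 b c hb hne hn)⟩,
        fun hc => ?_⟩
      obtain ⟨h3, h4⟩ := h.entry' hb hc hbc.1
      exact ⟨h3, h4 ▸ hbc.2⟩

theorem project (h : IsContraction w w' U ρ α) {Y Y' : V → V → Prop}
    (h1 : ∀ u v, u ∉ U → u ≠ v → Y' u v → Y u v)
    (h2 : ∀ u v, u ∈ U → u ≠ v → Y' u v → Y (α (ρ u)) (ρ u)) {x y : V} (hx : x ∉ U) (hy : y ∉ U)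
    (hxy : ReflTransGen (fun p q => 0 < w p q ∧ ¬ Y p q) x y) :
    ReflTransGen (fun p q => 0 < w' p q ∧ ¬ Y' p q) x y := by
  -- While the path runs inside a fibre, its image waits at the representative. The tail of the
  -- entry edge is recorded as reached as well, since an edge from the fibre back to that tail may
  -- have no counterpart in `w'`.
  suffices (y ∉ U → ReflTransGen (fun p q => 0 < w' p q ∧ ¬ Y' p q) x y) ∧
      (y ∈ U → ReflTransGen (fun p q => 0 < w' p q ∧ ¬ Y' p q) x (ρ y) ∧
        ReflTransGen (fun p q => 0 < w' p q ∧ ¬ Y' p q) x (α (ρ y)) ∧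
        ¬ Y (α (ρ y)) (ρ y)) from this.1 hy
  clear hy
  induction hxy with
  | refl => exact ⟨fun _ => .refl, fun h => absurd h hx⟩
  | @tail b c _ hbc ih =>
    rcases eq_or_ne b c with rfl | hne
    · exact ih
    by_cases hb : b ∈ U <;> by_cases hc : c ∈ U
    · refine ⟨fun h => absurd hc h, fun _ => ?_⟩
      rw [← h.inside b c hb hc hbc.1]
      exact ih.2 hb
    · refine ⟨fun _ => ?_, fun h => absurd h hc⟩
      obtain ⟨h3, h4, h5⟩ := ih.2 hb
      by_cases hcα : c = α (ρ b)
      · exact hcα ▸ h4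
      · refine h3.tail ⟨h.exit' b c hb hc hbc.1 hcα, fun hn => h5 ?_⟩
        have := h2 (ρ b) c (h.rep_mem b hb) (by rintro rfl; exact hc (h.rep_mem b hb)) hn
        rwa [h.rep_rep b hb] at this
    · refine ⟨fun h => absurd hc h, fun _ => ?_⟩
      obtain ⟨-, h3, h4⟩ := h.entry b c hb hc hbc.1
      rw [← h3, ← h4]
      exact ⟨(ih.1 hb).tail ⟨(h.pos_iff hb hne).1 hbc.1, fun hn => hbc.2 (h1 b c hb hne hn)⟩,
        ih.1 hb, hbc.2⟩
    · exact ⟨fun _ => (ih.1 hb).tail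
        ⟨(h.pos_iff hb hne).1 hbc.1, fun hn => hbc.2 (h1 b c hb hne hn)⟩, fun h => absurd h hc⟩

theorem twinlessLinked_lift (h : IsContraction w w' U ρ α) {Y Y' : V → V → Prop}
    (h1 : ∀ u v, u ∉ U → u ≠ v → Y u v → Y' u v)
    (h2 : ∀ u v, u ∈ U → u ≠ v → Y u v → Y' (α (ρ u)) (ρ u)) {x y : V} (hx : x ∉ U) (hy : y ∉ U)
    (hxy : TwinlessLinked (fun p q => 0 < w' p q ∧ ¬ Y' p q) x y) :
    TwinlessLinked (fun p q => 0 < w p q ∧ ¬ Y p q) x y := by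
  refine ⟨h.lift h1 h2 hx hxy.fwd, h.lift h1 h2 hy hxy.bwd, fun u v => ?_⟩
  by_cases huv : u ∈ U ∨ v ∈ U
  · exact (h.fibered.mono fun _ _ h => h.1).twin hx hy huv (h.lift h1 h2 hx hxy.fwd)
      (h.lift h1 h2 hy hxy.bwd)
  · push Not at huv
    have key : ∀ a b, a ∉ U → ∀ p q, p ∉ U →
        ReflTransGen (dropEdge (fun p q => 0 < w' p q ∧ ¬ Y' p q) a b) p q →
        ReflTransGen (dropEdge (fun p q => 0 < w p q ∧ ¬ Y p q) a b) p q := by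
      intro a b ha p q hp hpq
      refine (h.lift (Y := fun p q => Y p q ∨ p = a ∧ q = b)
        (Y' := fun p q => Y' p q ∨ p = a ∧ q = b) (fun u v hu hne => Or.imp_left (h1 u v hu hne))
        ?_ hp (hpq.weaken ?_)).weaken ?_
      · rintro u v hu hne (h3 | ⟨rfl, -⟩)
        · exact Or.inl (h2 u v hu hne h3)
        · exact absurd hu ha
      · exact fun c d hcd => ⟨hcd.1.1, fun hn => hn.elim hcd.1.2 hcd.2⟩
      · exact fun c d hcd => ⟨⟨hcd.1, fun hn => hcd.2 (Or.inl hn)⟩, fun hn => hcd.2 (Or.inr hn)⟩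
    exact (hxy.twin u v).imp (key u v huv.1 x y hx) (key v u huv.2 y x hy)

theorem twinlessLinked_project (h : IsContraction w w' U ρ α) {Y Y' : V → V → Prop}
    (h1 : ∀ u v, u ∉ U → u ≠ v → Y' u v → Y u v)
    (h2 : ∀ u v, u ∈ U → u ≠ v → Y' u v → Y (α (ρ u)) (ρ u)) {x y : V} (hx : x ∉ U) (hy : y ∉ U)
    (hxy : TwinlessLinked (fun p q => 0 < w p q ∧ ¬ Y p q) x y) :
    TwinlessLinked (fun p q => 0 < w' p q ∧ ¬ Y' p q) x y := by
  refine ⟨h.project h1 h2 hx hy hxy.fwd, h.project h1 h2 hy hx hxy.bwd, fun u v => ?_⟩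
  by_cases huv : u ∈ U ∨ v ∈ U
  · exact (h.fibered'.mono fun _ _ h => h.1).twin hx hy huv (h.project h1 h2 hx hy hxy.fwd)
      (h.project h1 h2 hy hx hxy.bwd)
  · push Not at huv
    have key : ∀ a b, a ∉ U → ∀ p q, p ∉ U → q ∉ U →
        ReflTransGen (dropEdge (fun p q => 0 < w p q ∧ ¬ Y p q) a b) p q →
        ReflTransGen (dropEdge (fun p q => 0 < w' p q ∧ ¬ Y' p q) a b) p q := by
      intro a b ha p q hp hq hpq
      refine (h.project (Y := fun p q => Y p q ∨ p = a ∧ q = b)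
        (Y' := fun p q => Y' p q ∨ p = a ∧ q = b) (fun u v hu hne => Or.imp_left (h1 u v hu hne))
        ?_ hp hq (hpq.weaken ?_)).weaken ?_
      · rintro u v hu hne (h3 | ⟨rfl, -⟩)
        · exact Or.inl (h2 u v hu hne h3)
        · exact absurd hu ha
      · exact fun c d hcd => ⟨hcd.1.1, fun hn => hn.elim hcd.1.2 hcd.2⟩
      · exact fun c d hcd => ⟨⟨hcd.1, fun hn => hcd.2 (Or.inl hn)⟩, fun hn => hcd.2 (Or.inr hn)⟩
    exact (hxy.twin u v).imp (key u v huv.1 x y hx hy) (key v u huv.2 y x hy hx)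

/-- Deleting an edge outside the fibres corresponds to the same deletion on the other side. Deleting
one with its tail in a fibre is no worse than deleting the entry edge of that fibre, which is simple
in both graphs, so the hypothesis applies to it. -/
theorem twoEdgeLinked_iff (h : IsContraction w w' U ρ α) {x y : V} (hx : x ∉ U) (hy : y ∉ U) :
    TwoEdgeLinked w x y ↔ TwoEdgeLinked w' x y := by
  have htail : ∀ p ∈ U, w (α (ρ p)) (ρ p) ≤ 1 := by
    intro p hp
    have := h.entry (α (ρ p)) (ρ p) (h.tail_notMem p hp) (h.rep_mem p hp)
    omega
  have htail' : ∀ p ∈ U, w' (α (ρ p)) (ρ p) ≤ 1 := by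
    intro p hp
    have h3 := htail p hp
    have := h.agree (α (ρ p)) (ρ p) (h.tail_notMem p hp)
      fun he => h.tail_notMem p hp (by rw [he]; exact h.rep_mem p hp)
    omega
  constructor
  · rintro ⟨h0, h1⟩
    have h0' : ∀ Y' : V → V → Prop, (∀ u v, u ≠ v → ¬ Y' u v) →
        TwinlessLinked (fun p q => 0 < w' p q ∧ ¬ Y' p q) x y := fun Y' hY' =>
      h.twinlessLinked_project (Y := fun _ _ => False)
        (fun u v _ hne => hY' u v hne) (fun u v _ hne hn => absurd hn (hY' u v hne)) hx hy
        (h0.weaken fun _ _ h => ⟨h, fun h => h⟩)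
    refine ⟨(h0' (fun _ _ => False) fun _ _ _ h => h).weaken fun _ _ h => h.1, fun p q hpq => ?_⟩
    rcases eq_or_ne p q with rfl | hne
    · exact h0' _ fun u v hne h => hne (h.1.trans h.2.symm)
    by_cases hp : p ∈ U
    · refine h.twinlessLinked_project ?_ ?_ hx hy (h1 (α (ρ p)) (ρ p) (htail p hp))
      · rintro u v hu - ⟨rfl, rfl⟩
        exact absurd hp hu
      · rintro u v hu - ⟨rfl, rfl⟩
        exact ⟨rfl, rfl⟩
    · refine h.twinlessLinked_project ?_ ?_ hx hy
        (h1 p q (by have := h.agree p q hp hne; omega))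
      · exact fun u v _ _ h => h
      · rintro u v hu - ⟨rfl, rfl⟩
        exact absurd hu hp
  · rintro ⟨h0, h1⟩
    have h0' : ∀ Y : V → V → Prop, (∀ u v, u ≠ v → ¬ Y u v) →
        TwinlessLinked (fun p q => 0 < w p q ∧ ¬ Y p q) x y := fun Y hY =>
      h.twinlessLinked_lift (Y' := fun _ _ => False)
        (fun u v _ hne => hY u v hne) (fun u v _ hne hn => absurd hn (hY u v hne)) hx hy
        (h0.weaken fun _ _ h => ⟨h, fun h => h⟩)
    refine ⟨(h0' (fun _ _ => False) fun _ _ _ h => h).weaken fun _ _ h => h.1, fun p q hpq => ?_⟩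
    rcases eq_or_ne p q with rfl | hne
    · exact h0' _ fun u v hne h => hne (h.1.trans h.2.symm)
    by_cases hp : p ∈ U
    · refine h.twinlessLinked_lift ?_ ?_ hx hy (h1 (α (ρ p)) (ρ p) (htail' p hp))
      · rintro u v hu - ⟨rfl, rfl⟩
        exact absurd hp hu
      · rintro u v hu - ⟨rfl, rfl⟩
        exact ⟨rfl, rfl⟩
    · refine h.twinlessLinked_lift ?_ ?_ hx hy
        (h1 p q (by have := h.agree p q hp hne; omega))
      · exact fun u v _ _ h => h
      · rintro u v hu - ⟨rfl, rfl⟩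
        exact absurd hu hp

end IsContraction

end Contraction

end MultiDigraph

namespace MultiDigraph

/-! ### Dominators and bridges of a flow graph. -/

section Dominators

variable {V : Type*}

theorem reflTransGen_last {E : V → V → Prop} (X : Set V) {p x : V} (h : ReflTransGen E p x) :
    ReflTransGen (fun a b => E a b ∧ b ∉ X) p x ∨
      ∃ c ∈ X, ReflTransGen E p c ∧ ReflTransGen (fun a b => E a b ∧ b ∉ X) c x := by
  induction h with
  | refl => exact Or.inl .refl
  | @tail b c hpb hbc ih =>
    by_cases hc : c ∈ X
    · exact Or.inr ⟨c, hc, hpb.tail hbc, .refl⟩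
    · rcases ih with ih | ⟨d, hd, h1, h2⟩
      · exact Or.inl (ih.tail ⟨hbc, hc⟩)
      · exact Or.inr ⟨d, hd, h1, h2.tail ⟨hbc, hc⟩⟩

theorem reflTransGen_enter {E : V → V → Prop} {X : Set V} {p x : V} (h : ReflTransGen E p x)
    (hx : x ∈ X) (hp : p ∉ X) :
    ∃ b, ∃ c ∈ X, ReflTransGen (fun a b => E a b ∧ b ∉ X) p b ∧ E b c := by
  induction h using ReflTransGen.head_induction_on with
  | refl => exact absurd hx hp
  | @head a c hac _ ih =>
    by_cases hc : c ∈ X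
    · exact ⟨a, c, hc, .refl, hac⟩
    · obtain ⟨b, d, hd, h1, h2⟩ := ih hc
      exact ⟨b, d, hd, .head ⟨hac, hc⟩ h1, h2⟩

/-- There is a path from `s` to `v` that does not contain `u`. -/
def Avoids (G : MultiDigraph V) (s u v : V) : Prop :=
  s ≠ u ∧ ReflTransGen (fun p q => G.Adj p q ∧ q ≠ u) s v

variable {G : MultiDigraph V} {s : V}

theorem exists_isWalk_iff_avoids {u v : V} :
    (∃ l, G.IsWalk s v l ∧ u ∉ l) ↔ s ∈ G.verts ∧ G.Avoids s u v := by
  constructor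
  · rintro ⟨l, hl, hu⟩
    induction hl with
    | single hv => exact ⟨hv, fun h => hu (by simp [h]), .refl⟩
    | cons h _ ih =>
      simp only [List.mem_cons, not_or] at hu
      obtain ⟨-, h1, h2⟩ := ih hu.2
      exact ⟨G.left_mem h, fun he => hu.1 he.symm, .head ⟨h, h1⟩ h2⟩
  · rintro ⟨hs, hne, h⟩
    induction h using ReflTransGen.head_induction_on with
    | refl => exact ⟨_, .single hs, by simpa using hne.symm⟩
    | head hac _ ih =>
      obtain ⟨l, hl, hul⟩ := ih (G.right_mem hac.1) hac.2
      exact ⟨_, .cons hac.1 hl, by simpa using ⟨hne.symm, hul⟩⟩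

theorem dominates_iff (hs : s ∈ G.verts) {u v : V} :
    G.Dominates s u v ↔ u ∈ G.verts ∧ v ∈ G.verts ∧ ¬ G.Avoids s u v := by
  refine and_congr_right fun _ => and_congr_right fun _ => ?_
  rw [← not_iff_not, not_not]
  push Not
  rw [exists_isWalk_iff_avoids]
  simp [hs]

theorem avoids_of_not_dominates (hs : s ∈ G.verts) {u v : V} (hu : u ∈ G.verts)
    (hv : v ∈ G.verts) (h : ¬ G.Dominates s u v) : G.Avoids s u v := by
  by_contra hn
  exact h ((dominates_iff hs).2 ⟨hu, hv, hn⟩)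

theorem Dominates.not_avoids {u v : V} (h : G.Dominates s u v) (hs : s ∈ G.verts) :
    ¬ G.Avoids s u v := ((dominates_iff hs).1 h).2.2

theorem Avoids.ne {u v : V} (h : G.Avoids s u v) : v ≠ u := by
  rcases h.2.cases_tail with h1 | ⟨c, -, hc⟩
  · exact h1 ▸ h.1
  · exact hc.2

theorem Avoids.tail {u v x : V} (h : G.Avoids s u v) (hvx : G.Adj v x) (hx : x ≠ u) :
    G.Avoids s u x := ⟨h.1, h.2.tail ⟨hvx, hx⟩⟩

theorem Avoids.reach_dropEdge {u v : V} (a : V) (h : G.Avoids s u v) :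
    ReflTransGen (dropEdge G.Adj a u) s v :=
  h.2.weaken fun _ _ hpq => ⟨hpq.1, fun he => hpq.2 he.2⟩

theorem dominates_refl (hs : s ∈ G.verts) {v : V} (hv : v ∈ G.verts) : G.Dominates s v v :=
  (dominates_iff hs).2 ⟨hv, hv, fun h => h.ne rfl⟩

theorem dominates_start (hs : s ∈ G.verts) {v : V} (hv : v ∈ G.verts) : G.Dominates s s v :=
  (dominates_iff hs).2 ⟨hs, hv, fun h => h.1 rfl⟩

theorem Dominates.trans {u v x : V} (h : G.Dominates s u v) (h' : G.Dominates s v x)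
    (hs : s ∈ G.verts) : G.Dominates s u x := by
  refine (dominates_iff hs).2 ⟨h.1, h'.2.1, fun hn => ?_⟩
  rcases reflTransGen_last {v} hn.2 with h1 | ⟨c, rfl, h1, -⟩
  · rcases eq_or_ne s v with rfl | hne
    · exact h.not_avoids hs ⟨hn.1, .refl⟩
    · exact h'.not_avoids hs ⟨hne, h1.weaken fun p q hpq => ⟨hpq.1.1, hpq.2⟩⟩
  · exact h.not_avoids hs ⟨hn.1, h1⟩

/-- A path from `s` enters `{u, v}` first at one of the two vertices, so it reaches that one without
the other. -/
theorem Dominates.antisymm {u v : V} (h : G.Dominates s u v) (h' : G.Dominates s v u)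
    (hs : s ∈ G.verts) (hG : G.StronglyConnected) : u = v := by
  by_contra hne
  have hsu : s ≠ u := by
    rintro rfl
    exact h'.not_avoids hs ⟨hne, .refl⟩
  have hsv : s ≠ v := by
    rintro rfl
    exact h.not_avoids hs ⟨hsu, .refl⟩
  obtain ⟨b, c, hc, hsb, hbc⟩ := reflTransGen_enter (X := {u, v}) (hG.reach hs h.1)
    (by simp) (by simp [hsu, hsv])
  rcases hc with rfl | rfl
  · refine h'.not_avoids hs (Avoids.tail ⟨hsv, hsb.weaken fun p q hpq => ⟨hpq.1, ?_⟩⟩ hbc hne)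
    rintro rfl
    exact hpq.2 (by simp)
  · refine h.not_avoids hs
      (Avoids.tail ⟨hsu, hsb.weaken fun p q hpq => ⟨hpq.1, ?_⟩⟩ hbc (Ne.symm hne))
    rintro rfl
    exact hpq.2 (by simp)

/-- After the last visit to `{u, v}`, a path to `x` avoids both. Reaching the last visited vertex
without the other one would then give a path to `x` that avoids a dominator. -/
theorem Dominates.total {u v x : V} (h : G.Dominates s u x) (h' : G.Dominates s v x)
    (hs : s ∈ G.verts) (hG : G.StronglyConnected) :
    G.Dominates s u v ∨ G.Dominates s v u := by
  by_contra! hn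
  have h1 := avoids_of_not_dominates hs h.1 h'.1 hn.1
  have h2 := avoids_of_not_dominates hs h'.1 h.1 hn.2
  rcases reflTransGen_last {u, v} (hG.reach hs h.2.1) with h3 | ⟨c, rfl | rfl, -, h3⟩
  · refine h.not_avoids hs ⟨h1.1, h3.weaken fun p q hpq => ⟨hpq.1, ?_⟩⟩
    rintro rfl
    exact hpq.2 (by simp)
  · refine h'.not_avoids hs ⟨h2.1, h2.2.trans (h3.weaken fun p q hpq => ⟨hpq.1, ?_⟩)⟩
    rintro rfl
    exact hpq.2 (by simp)
  · refine h.not_avoids hs ⟨h1.1, h1.2.trans (h3.weaken fun p q hpq => ⟨hpq.1, ?_⟩)⟩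
    rintro rfl
    exact hpq.2 (by simp)

/-- After its last visit to `b`, a path to `v` stays in the set dominated by `b`: any other vertex
is reachable from `s` without `b`, and continuing along the path would avoid `b` up to `v`. -/
theorem Dominates.reach_inside {b v : V} (h : G.Dominates s b v) (hs : s ∈ G.verts)
    (hG : G.StronglyConnected) :
    ReflTransGen (fun p q => G.Adj p q ∧ G.Dominates s b p ∧ G.Dominates s b q) b v := by
  have key : ReflTransGen (fun p q => G.Adj p q ∧ q ≠ b) b v := by
    rcases reflTransGen_last {b} (hG.reach hs h.2.1) with h1 | ⟨c, rfl, -, h1⟩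
    · rcases eq_or_ne s b with rfl | hne
      · exact h1
      · exact absurd ⟨hne, h1⟩ (h.not_avoids hs)
    · exact h1
  refine (reflTransGen_restrict (W := {m | G.Dominates s b m}) key fun m h1 h2 => ?_).weaken
    fun p q hpq => ⟨hpq.1.1, hpq.2⟩
  by_contra hn
  have := avoids_of_not_dominates hs h.1
    (mem_verts_of_reach h.1 (h1.weaken fun p q hpq => hpq.1)) hn
  exact h.not_avoids hs ⟨this.1, this.2.trans h2⟩

theorem IsBridge.mult_eq_one {a b : V} (h : G.IsBridge s a b) (hs : s ∈ G.verts)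
    (hG : G.StronglyConnected) : G.mult a b = 1 := by
  by_contra hne
  have h0 := h.1
  refine h.2 (Reaches.iff_reflTransGen.2 ⟨hs, (hG.reach hs (G.right_mem h.1)).weaken
    fun p q hpq => (adj_deleteEdge G).2 ⟨hpq, ?_⟩⟩)
  rintro ⟨rfl, rfl⟩
  omega

theorem IsBridge.not_reach {a b : V} (h : G.IsBridge s a b) (hs : s ∈ G.verts)
    (hG : G.StronglyConnected) : ¬ ReflTransGen (dropEdge G.Adj a b) s b := by
  rw [← adj_deleteEdge_of_le_one G (h.mult_eq_one hs hG).le]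
  exact fun hn => h.2 (Reaches.iff_reflTransGen.2 ⟨hs, hn⟩)

theorem IsBridge.start_ne {a b : V} (h : G.IsBridge s a b) (hs : s ∈ G.verts)
    (hG : G.StronglyConnected) : s ≠ b := by
  rintro rfl
  exact h.not_reach hs hG .refl

theorem IsBridge.not_dominates_tail {a b : V} (h : G.IsBridge s a b) (hs : s ∈ G.verts)
    (hG : G.StronglyConnected) : ¬ G.Dominates s b a := by
  intro hd
  have h1 := h.not_reach hs hG
  rcases reflTransGen_dropEdge_or a b (hG.reach hs (G.right_mem h.1)) with h2 | ⟨h2, -⟩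
  · exact h1 h2
  rcases reflTransGen_last {b} h2 with h3 | ⟨c, rfl, h3, -⟩
  · exact hd.not_avoids hs ⟨h.start_ne hs hG, h3.weaken fun p q hpq => ⟨hpq.1.1, hpq.2⟩⟩
  · exact h1 h3

/-- The bridge `(a, b)` is the only edge that enters the set of vertices dominated by `b`. -/
theorem IsBridge.entry {a b u v : V} (h : G.IsBridge s a b) (hs : s ∈ G.verts)
    (hG : G.StronglyConnected) (hu : ¬ G.Dominates s b u) (hv : G.Dominates s b v)
    (huv : G.Adj u v) : u = a ∧ v = b := by
  have hav := avoids_of_not_dominates hs hv.1 (G.left_mem huv) hu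
  have hvb : v = b := by
    by_contra hne
    exact hv.not_avoids hs (hav.tail huv hne)
  subst hvb
  refine ⟨?_, rfl⟩
  by_contra hne
  exact h.not_reach hs hG ((hav.reach_dropEdge a).tail ⟨huv, fun he => hne he.1⟩)

theorem IsBridge.isIdom {a b : V} (h : G.IsBridge s a b) (hs : s ∈ G.verts)
    (hG : G.StronglyConnected) : G.IsIdom s a b := by
  have ha := G.left_mem h.1
  have hb := G.right_mem h.1
  have hab : a ≠ b := by
    rintro rfl
    exact h.not_dominates_tail hs hG (dominates_refl hs ha)
  refine ⟨(dominates_iff hs).2 ⟨ha, hb, fun hn => h.not_reach hs hG ?_⟩, hab, fun w hw hne => ?_⟩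
  · rcases reflTransGen_dropEdge_or a b (hn.2) with h1 | ⟨h1, -⟩
    · exact h1.weaken fun p q hpq => ⟨hpq.1.1, hpq.2⟩
    · exact absurd rfl (Avoids.ne ⟨hn.1, h1.weaken fun p q hpq => hpq.1⟩)
  · by_contra hn
    exact hw.not_avoids hs ((avoids_of_not_dominates hs hw.1 ha hn).tail h.1 hne.symm)

theorem IsIdom.unique {a d b : V} (h : G.IsIdom s a b) (h' : G.IsIdom s d b) (hs : s ∈ G.verts)
    (hG : G.StronglyConnected) : a = d :=
  Dominates.antisymm (h'.2.2 a h.1 h.2.1) (h.2.2 d h'.1 h'.2.1) hs hG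

theorem IsBridge.eq_of_isIdom {a d b : V} (h : G.IsBridge s a b) (h' : G.IsIdom s d b)
    (hs : s ∈ G.verts) (hG : G.StronglyConnected) : d = a :=
  h'.unique (h.isIdom hs hG) hs hG

/-- A path from `v` to `b` first enters the set dominated by `b` along the bridge, hence from `a`.
-/
theorem IsBridge.reach_outside {a b v : V} (h : G.IsBridge s a b) (hs : s ∈ G.verts)
    (hG : G.StronglyConnected) (hv : v ∈ G.verts) (hbv : ¬ G.Dominates s b v) :
    ReflTransGen (fun p q => G.Adj p q ∧ ¬ G.Dominates s b p ∧ ¬ G.Dominates s b q) v a := by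
  have hb := G.right_mem h.1
  have hbb := dominates_refl hs hb
  have := hG.reach hv hb
  induction this using ReflTransGen.head_induction_on with
  | refl => exact absurd hbb hbv
  | @head p q hpq _ ih =>
    by_cases hq : G.Dominates s b q
    · rw [(h.entry hs hG hbv hq hpq).1]
    · exact .head ⟨hpq, hbv, hq⟩ (ih (G.right_mem hpq) hq)

theorem IsBridge.dominates_of_reach {a b x y : V} (h : G.IsBridge s a b) (hs : s ∈ G.verts)
    (hG : G.StronglyConnected) (hx : G.Dominates s b x)
    (hyx : ReflTransGen (dropEdge G.Adj a b) y x) : G.Dominates s b y := by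
  by_contra hn
  refine mem_of_reflTransGen (S := {m | ¬ G.Dominates s b m}) ?_ hyx hn hx
  intro p hp q hpq hq
  exact hpq.2 (h.entry hs hG hp hq hpq.1)

/-- The number of dominators measures depth in the dominator tree; it serves to pick deepest and
shallowest marked vertices. -/
theorem Dominates.ncard_lt [Finite V] {a b : V} (h : G.Dominates s a b) (hne : a ≠ b)
    (hs : s ∈ G.verts) (hG : G.StronglyConnected) :
    {u | G.Dominates s u a}.ncard < {u | G.Dominates s u b}.ncard := by
  refine Set.ncard_lt_ncard ⟨fun u (hu : G.Dominates s u a) => hu.trans h hs, fun hsub => ?_⟩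
    (Set.toFinite _)
  exact hne (h.antisymm (hsub (show G.Dominates s b b from dominates_refl hs h.2.1)) hs hG)

/-- The root is the deepest dominator of `x` that is marked or equal to `s`. -/
theorem exists_mem_tree [Finite V] (hs : s ∈ G.verts) (hG : G.StronglyConnected) {x : V}
    (hx : x ∈ G.verts) : ∃ r, (r = s ∨ G.Marked s r) ∧ x ∈ G.tree s r := by
  obtain ⟨r, ⟨hr, hrx⟩, hmax⟩ := Set.exists_max_image
    {r | (r = s ∨ G.Marked s r) ∧ G.Dominates s r x} (fun r => {u | G.Dominates s u r}.ncard)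
    (Set.toFinite _) ⟨s, Or.inl rfl, dominates_start hs hx⟩
  refine ⟨r, hr, hrx, fun z hz hzx hne hm => ?_⟩
  exact (hmax z ⟨Or.inr hm, hzx⟩).not_gt (hz.ncard_lt hne.symm hs hG)

/-- Once a bridge into `z` is deleted, no vertex outside the set dominated by `z` reaches it. Hence
`x` and `y` have the same marked dominators, and these determine the tree. -/
theorem TwoEdgeLinked.mem_tree (hs : s ∈ G.verts) (hG : G.StronglyConnected) {x y r : V}
    (hy : y ∈ G.verts) (h : TwoEdgeLinked G.mult x y) (hr : r = s ∨ G.Marked s r)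
    (hx : x ∈ G.tree s r) : y ∈ G.tree s r := by
  have hxv := hx.1.2.1
  have key : ∀ z, G.Marked s z → (G.Dominates s z x ↔ G.Dominates s z y) := by
    rintro z ⟨a, hb⟩
    have := h.2 a z (hb.mult_eq_one hs hG).le
    exact ⟨fun hz => hb.dominates_of_reach hs hG hz this.bwd,
      fun hz => hb.dominates_of_reach hs hG hz this.fwd⟩
  refine ⟨?_, fun z hz hzy hne hm => hx.2 z hz ((key z hm).2 hzy) hne hm⟩
  rcases hr with rfl | hr
  · exact dominates_start hs hy
  · exact (key r hr).1 hx.1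

theorem root_mem_tree (hs : s ∈ G.verts) (hG : G.StronglyConnected) {r : V} (hr : r ∈ G.verts) :
    r ∈ G.tree s r :=
  ⟨dominates_refl hs hr, fun _ h1 h2 hne => absurd (h2.antisymm h1 hs hG) hne⟩

end Dominators

end MultiDigraph

namespace MultiDigraph

/-! ### The auxiliary graph preserves the relation between ordinary vertices. -/

section Auxiliary

variable {V : Type*} {G : MultiDigraph V} {s r : V}

/-- The vertex `z` is marked and `d(z)` is in `T(r)`. -/
def Child (G : MultiDigraph V) (s r z : V) : Prop :=
  G.Marked s z ∧ ∃ d ∈ G.tree s r, G.IsIdom s d z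

theorem Marked.mem_verts {z : V} (h : G.Marked s z) : z ∈ G.verts :=
  let ⟨_, ha⟩ := h; G.right_mem ha.1

theorem Child.tail_mem_tree {a z : V} (h : G.Child s r z) (hb : G.IsBridge s a z)
    (hs : s ∈ G.verts) (hG : G.StronglyConnected) : a ∈ G.tree s r := by
  obtain ⟨-, d, hd, hi⟩ := h
  exact hb.eq_of_isIdom hi hs hG ▸ hd

theorem Child.not_dominates {v z : V} (h : G.Child s r z) (hv : v ∈ G.tree s r)
    (hs : s ∈ G.verts) (hG : G.StronglyConnected) : ¬ G.Dominates s z v := by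
  intro hzv
  obtain ⟨a, hb⟩ := h.1
  have ha := h.tail_mem_tree hb hs hG
  have haz := (hb.isIdom hs hG).1
  refine hv.2 z (ha.1.trans haz hs) hzv ?_ h.1
  rintro rfl
  exact hb.not_dominates_tail hs hG ha.1

theorem Child.dominates {z : V} (h : G.Child s r z) (hs : s ∈ G.verts) : G.Dominates s r z := by
  obtain ⟨-, d, hd, hi⟩ := h
  exact hd.1.trans hi.1 hs

theorem Child.unique {z z' v : V} (h : G.Child s r z) (h' : G.Child s r z')
    (hv : G.Dominates s z v) (hv' : G.Dominates s z' v) (hs : s ∈ G.verts)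
    (hG : G.StronglyConnected) : z = z' := by
  have key : ∀ z z', G.Child s r z → G.Child s r z' → G.Dominates s z z' → z = z' := by
    intro z z' h h' hd
    by_contra hne
    obtain ⟨-, d, hd', hi⟩ := h'
    exact h.not_dominates hd' hs hG (hi.2.2 z hd hne)
  rcases hv.total hv' hs hG with hd | hd
  · exact key _ _ h h' hd
  · exact (key _ _ h' h hd).symm

/-- Among the marked vertices other than `r` between `r` and `v`, the shallowest one has its
immediate dominator in `T(r)`. -/
theorem mem_tree_or_exists_child [Finite V] {v : V} (hs : s ∈ G.verts) (hG : G.StronglyConnected)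
    (hv : G.Dominates s r v) : v ∈ G.tree s r ∨ ∃ z, G.Child s r z ∧ G.Dominates s z v := by
  refine or_iff_not_imp_left.2 fun hn => ?_
  have hne : {z | (G.Dominates s r z ∧ z ≠ r ∧ G.Marked s z) ∧ G.Dominates s z v}.Nonempty := by
    by_contra hempty
    refine hn ⟨hv, fun z h1 h2 h3 h4 => hempty ⟨z, ⟨h1, h3, h4⟩, h2⟩⟩
  obtain ⟨z, ⟨⟨hrz, hzr, hz⟩, hzv⟩, hmin⟩ := Set.exists_min_image _
    (fun z => {u | G.Dominates s u z}.ncard) (Set.toFinite _) hne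
  obtain ⟨a, hb⟩ := hz
  have hi := hb.isIdom hs hG
  refine ⟨z, ⟨⟨a, hb⟩, a, ⟨hi.2.2 r hrz hzr.symm, fun z' h1 h2 h3 h4 => ?_⟩, hi⟩, hzv⟩
  have hz' := h2.trans hi.1 hs
  refine (hmin z' ⟨⟨h1, h3, h4⟩, hz'.trans hzv hs⟩).not_gt (hz'.ncard_lt ?_ hs hG)
  rintro rfl
  exact hb.not_dominates_tail hs hG h2

theorem exists_bridge_of_not_dominates {v : V} (hs : s ∈ G.verts) (hr : r = s ∨ G.Marked s r)
    (hv : v ∈ G.verts) (hn : ¬ G.Dominates s r v) : r ≠ s ∧ ∃ e, G.IsBridge s e r := by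
  have hne : r ≠ s := by
    rintro rfl
    exact hn (dominates_start hs hv)
  exact ⟨hne, hr.resolve_left hne⟩

theorem ShrinksTo.mem_verts {v a : V} (h : G.ShrinksTo s r v a) : v ∈ G.verts := by
  rcases h with ⟨h, -⟩ | ⟨-, -, h⟩ | ⟨-, -, h, -⟩
  · exact h.1.2.1
  · exact h.2.1
  · exact h

theorem shrinksTo_of_mem_tree {v : V} (h : v ∈ G.tree s r) : G.ShrinksTo s r v v :=
  Or.inl ⟨h, rfl⟩

theorem Child.shrinksTo {v z : V} (h : G.Child s r z) (hv : G.Dominates s z v) :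
    G.ShrinksTo s r v z := Or.inr (Or.inl ⟨h.1, h.2, hv⟩)

theorem IsBridge.shrinksTo {e v : V} (h : G.IsBridge s e r) (hs : s ∈ G.verts)
    (hG : G.StronglyConnected) (hv : v ∈ G.verts) (hn : ¬ G.Dominates s r v) :
    G.ShrinksTo s r v e :=
  Or.inr (Or.inr ⟨(h.start_ne hs hG).symm, h.isIdom hs hG, hv, hn⟩)

/-- The three ways in which `v` is shrunk into `a`. -/
theorem shrinksTo_cases {v a : V} (h : G.ShrinksTo s r v a) :
    (v ∈ G.tree s r ∧ a = v) ∨ (G.Child s r a ∧ G.Dominates s a v) ∨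
      (r ≠ s ∧ G.IsIdom s a r ∧ v ∈ G.verts ∧ ¬ G.Dominates s r v) := by
  rcases h with h | ⟨h1, h2, h3⟩ | h
  · exact Or.inl h
  · exact Or.inr (Or.inl ⟨⟨h1, h2⟩, h3⟩)
  · exact Or.inr (Or.inr h)

theorem exists_shrinksTo [Finite V] {v : V} (hs : s ∈ G.verts) (hG : G.StronglyConnected)
    (hr : r = s ∨ G.Marked s r) (hv : v ∈ G.verts) : ∃ a, G.ShrinksTo s r v a := by
  by_cases hd : G.Dominates s r v
  · rcases mem_tree_or_exists_child hs hG hd with h | ⟨z, hz, hzv⟩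
    · exact ⟨v, shrinksTo_of_mem_tree h⟩
    · exact ⟨z, hz.shrinksTo hzv⟩
  · obtain ⟨-, e, he⟩ := exists_bridge_of_not_dominates hs hr hv hd
    exact ⟨e, he.shrinksTo hs hG hv hd⟩

theorem ShrinksTo.unique {v a b : V} (h : G.ShrinksTo s r v a) (h' : G.ShrinksTo s r v b)
    (hs : s ∈ G.verts) (hG : G.StronglyConnected) : a = b := by
  rcases shrinksTo_cases h with ⟨h1, rfl⟩ | ⟨h1, h2⟩ | ⟨h1, h2, h3, h4⟩ <;>
  rcases shrinksTo_cases h' with ⟨h1', rfl⟩ | ⟨h1', h2'⟩ | ⟨h1', h2', h3', h4'⟩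
  · rfl
  · exact absurd h2' (h1'.not_dominates h1 hs hG)
  · exact absurd h1.1 h4'
  · exact absurd h2 (h1.not_dominates h1' hs hG)
  · exact h1.unique h1' h2 h2' hs hG
  · exact absurd ((h1.dominates hs).trans h2 hs) h4'
  · exact absurd h1'.1 h4
  · exact absurd ((h1'.dominates hs).trans h2' hs) h4
  · exact h2.unique h2' hs hG

theorem TwoEdgeTwinlessConn.mem_verts {x y : V} (h : G.TwoEdgeTwinlessConn x y) :
    x ∈ G.verts ∧ y ∈ G.verts := by
  obtain ⟨C, hC, hx, hy⟩ := h
  exact ⟨hC.1.1 hx, hC.1.1 hy⟩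

theorem StronglyConnected.reverse (hG : G.StronglyConnected) : G.reverse.StronglyConnected :=
  fun _ hu _ hv => Reaches.iff_reflTransGen.2 ⟨hu, (hG.reach hv hu).swap⟩

variable [Fintype V]

theorem shrinksTo_self (hs : s ∈ G.verts) (hG : G.StronglyConnected)
    (hr : r = s ∨ G.Marked s r) {a : V} (h : a ∈ (G.aux s r).verts) : G.ShrinksTo s r a a := by
  rcases h with (h | ⟨h1, h2⟩) | ⟨h1, h2⟩
  · exact shrinksTo_of_mem_tree h
  · exact Child.shrinksTo ⟨h1, h2⟩ (dominates_refl hs h1.mem_verts)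
  · obtain ⟨e, he⟩ := hr.resolve_left h1
    obtain rfl := he.eq_of_isIdom h2 hs hG
    exact he.shrinksTo hs hG (G.left_mem he.1) (he.not_dominates_tail hs hG)

theorem aux_mult_pos_iff {a b : V} : 0 < (G.aux s r).mult a b ↔
    a ≠ b ∧ ∃ u v, G.ShrinksTo s r u a ∧ G.ShrinksTo s r v b ∧ 0 < G.mult u v := by
  simp only [aux]
  split_ifs with h
  · simp [h]
  · rw [lt_min_iff]
    simp only [Nat.ofNat_pos, true_and, ne_eq, h, not_false_eq_true, Finset.sum_pos_iff,
      Finset.mem_univ]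
    refine exists_congr fun u => exists_congr fun v => ?_
    split_ifs with h'
    · simp [h']
    · simp only [lt_self_iff_false, false_iff]
      exact fun hn => h' ⟨hn.1, hn.2.1⟩

theorem aux_mult_eq {a b : V} (hne : a ≠ b)
    (h1 : ∀ u v, G.ShrinksTo s r u a → G.ShrinksTo s r v b → 0 < G.mult u v → u = a ∧ v = b)
    (h2 : 0 < G.mult a b → G.ShrinksTo s r a a ∧ G.ShrinksTo s r b b) :
    (G.aux s r).mult a b = min 2 (G.mult a b) := by
  simp only [aux, if_neg hne]
  congr 1
  rw [Finset.sum_eq_single a, Finset.sum_eq_single b]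
  · split_ifs with h
    · rfl
    · by_contra hn
      exact h (h2 (Nat.pos_of_ne_zero (Ne.symm hn)))
  · intro v _ hv
    split_ifs with h
    · by_contra hn
      exact hv (h1 a v h.1 h.2 (Nat.pos_of_ne_zero hn)).2
    · rfl
  · simp
  · intro u _ hu
    refine Finset.sum_eq_zero fun v _ => ?_
    split_ifs with h
    · by_contra hn
      exact hu (h1 u v h.1 h.2 (Nat.pos_of_ne_zero hn)).1
    · rfl
  · simp

theorem StronglyConnected.aux (hG : G.StronglyConnected) (hs : s ∈ G.verts)
    (hr : r = s ∨ G.Marked s r) : (G.aux s r).StronglyConnected := by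
  intro u hu v hv
  have huu := shrinksTo_self hs hG hr hu
  have hvv := shrinksTo_self hs hG hr hv
  refine Reaches.iff_reflTransGen.2 ⟨hu, ?_⟩
  have key : ∀ m, ReflTransGen G.Adj u m → ∀ a, G.ShrinksTo s r m a →
      ReflTransGen (G.aux s r).Adj u a := by
    intro m hm
    induction hm with
    | refl => exact fun a ha => huu.unique ha hs hG ▸ .refl
    | @tail b c _ hbc ih =>
      intro c' hc'
      obtain ⟨b', hb'⟩ := exists_shrinksTo hs hG hr (G.left_mem hbc)
      rcases eq_or_ne b' c' with rfl | hne
      · exact ih _ hb'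
      · exact (ih _ hb').tail (aux_mult_pos_iff.2 ⟨hne, b, c, hb', hc', hbc⟩)
  exact key v (hG.reach huu.mem_verts hvv.mem_verts) v hvv

/-- Two contractions give the auxiliary graph: first the sets `D(z)` that form `U`, entered by
bridges, and then, in the reversed graph, the complement `B` of `D(r)`, entered there by the
reversed bridge from `r` to `d(r)`. -/
theorem twoEdgeLinked_aux (hs : s ∈ G.verts) (hG : G.StronglyConnected)
    (hr : r = s ∨ G.Marked s r) {x y : V} (hx : x ∈ G.tree s r) (hy : y ∈ G.tree s r) :
    TwoEdgeLinked G.mult x y ↔ TwoEdgeLinked (G.aux s r).mult x y := by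
  classical
  have hrv : r ∈ G.verts := by
    rcases hr with rfl | hr
    · exact hs
    · exact hr.mem_verts
  have hrr := dominates_refl hs hrv
  set w := G.mult with hw
  set w' := (G.aux s r).mult with hw'
  set U : Set V := {v | ∃ z, G.Child s r z ∧ G.Dominates s z v} with hU
  set B : Set V := {v | v ∈ G.verts ∧ ¬ G.Dominates s r v} with hB
  have hρ' : ∀ v, ∃ z, v ∈ U → G.Child s r z ∧ G.Dominates s z v := fun v => by
    by_cases h : v ∈ U
    · exact h.imp fun z hz _ => hz
    · exact ⟨v, fun h' => absurd h' h⟩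
  choose ρ hρ using hρ'
  have hα' : ∀ z, ∃ a, G.Marked s z → G.IsBridge s a z := fun z => by
    by_cases h : G.Marked s z
    · exact h.imp fun a ha _ => ha
    · exact ⟨z, fun h' => absurd h' h⟩
  choose α hα using hα'
  have hρU : ∀ {z v}, G.Child s r z → G.Dominates s z v → ρ v = z := fun hz hv =>
    (hρ _ ⟨_, hz, hv⟩).1.unique hz (hρ _ ⟨_, hz, hv⟩).2 hv hs hG
  have childU : ∀ {z}, G.Child s r z → z ∈ U := fun hz => ⟨_, hz, dominates_refl hs hz.1.mem_verts⟩
  have hρρ : ∀ {z}, G.Child s r z → ρ z = z := fun hz => hρU hz (dominates_refl hs hz.1.mem_verts)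
  have treeU : ∀ {v}, v ∈ G.tree s r → v ∉ U := fun hv ⟨z, hz, hzv⟩ =>
    hz.not_dominates hv hs hG hzv
  have treeB : ∀ {v}, v ∈ G.tree s r → v ∉ B := fun hv h => h.2 hv.1
  have UB : ∀ {v}, v ∈ U → v ∉ B := fun ⟨z, hz, hzv⟩ h => h.2 ((hz.dominates hs).trans hzv hs)
  have mem_tree : ∀ {v}, v ∈ G.verts → v ∉ U → v ∉ B → v ∈ G.tree s r := by
    intro v hv hvU hvB
    refine (mem_tree_or_exists_child hs hG ?_).resolve_right hvU
    by_contra hn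
    exact hvB ⟨hv, hn⟩
  have domB : ∀ {v}, v ∈ G.verts → v ∉ B → G.Dominates s r v := fun hv hvB => by
    by_contra hn
    exact hvB ⟨hv, hn⟩
  have bridgeB : ∀ {v}, v ∈ B → ∃ e, G.IsBridge s e r := fun hv =>
    (exists_bridge_of_not_dominates hs hr hv.1 hv.2).2
  -- how vertices are shrunk, by the class of the target
  have toU : ∀ {v a}, a ∈ U → G.ShrinksTo s r v a → G.Child s r a ∧ G.Dominates s a v := by
    intro v a ha h
    rcases shrinksTo_cases h with ⟨h1, rfl⟩ | h1 | ⟨h1, h2, -⟩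
    · exact absurd ha (treeU h1)
    · exact h1
    · obtain ⟨e, he⟩ := hr.resolve_left h1
      obtain rfl := he.eq_of_isIdom h2 hs hG
      exact absurd ⟨G.left_mem he.1, he.not_dominates_tail hs hG⟩ (UB ha)
  have toB : ∀ {v a e}, G.IsBridge s e r → a ∈ B → G.ShrinksTo s r v a → a = e ∧ v ∈ B := by
    intro v a e he ha h
    rcases shrinksTo_cases h with ⟨h1, rfl⟩ | ⟨h1, -⟩ | ⟨-, h2, h3, h4⟩
    · exact absurd ha (treeB h1)
    · exact absurd ha (UB (childU h1))
    · exact ⟨he.eq_of_isIdom h2 hs hG, h3, h4⟩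
  have toT : ∀ {v a}, a ∉ U → a ∉ B → G.ShrinksTo s r v a → a ∈ G.tree s r ∧ v = a := by
    intro v a haU haB h
    rcases shrinksTo_cases h with ⟨h1, rfl⟩ | ⟨h1, -⟩ | ⟨h1, h2, -⟩
    · exact ⟨h1, rfl⟩
    · exact absurd (childU h1) haU
    · obtain ⟨e, he⟩ := hr.resolve_left h1
      obtain rfl := he.eq_of_isIdom h2 hs hG
      exact absurd ⟨G.left_mem he.1, he.not_dominates_tail hs hG⟩ haB
  have entryU : ∀ {u v z}, G.Child s r z → ¬ G.Dominates s z u → G.Dominates s z v → 0 < w u v →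
      u = α z ∧ v = z := fun hz hu hv huv => (hα _ hz.1).entry hs hG hu hv huv
  have tailT : ∀ {z}, G.Child s r z → α z ∈ G.tree s r := fun hz =>
    hz.tail_mem_tree (hα _ hz.1) hs hG
  -- The intermediate stage: the sets `D(z)` are contracted while the vertices of `B` are still
  -- separate. Edges from a contracted set into `B` are recorded only as present or absent; in the
  -- second, reversed contraction they leave the fibre, and there only positivity counts.
  set w₁ : V → V → ℕ := fun u v =>
    if v ∈ B then (if u ∈ U then (if u = ρ u ∧ ∃ u' ∈ U, ρ u' = u ∧ 0 < w u' v then 1 else 0)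
      else w u v)
    else if u ∈ B then w u v else w' u v with hw₁
  have w₁_UB : ∀ {u v}, u ∈ U → v ∈ B →
      (0 < w₁ u v ↔ u = ρ u ∧ ∃ u' ∈ U, ρ u' = u ∧ 0 < w u' v) := by
    intro u v hu hv
    simp only [hw₁, if_pos hv, if_pos hu]
    split_ifs with h
    · exact iff_of_true one_pos h
    · exact iff_of_false (lt_irrefl 0) h
  have w₁_B : ∀ {u v}, u ∉ U → v ∈ B → w₁ u v = w u v := fun hu hv => by
    simp only [hw₁, if_pos hv, if_neg hu]
  have w₁_B' : ∀ {u v}, u ∈ B → w₁ u v = w u v := fun {u v} hu => by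
    have := fun h => UB (v := u) h hu
    simp only [hw₁, if_pos hu, if_neg this, ite_self]
  have w₁_nB : ∀ {u v}, u ∉ B → v ∉ B → w₁ u v = w' u v := fun hu hv => by
    simp only [hw₁, if_neg hv, if_neg hu]
  have hc1 : IsContraction w w₁ U ρ α := by
    refine ⟨?_, ?_, ?_, ?_, ?_, ?_, ?_, ?_, ?_, ?_⟩
    · exact fun v hv => childU (hρ v hv).1
    · exact fun v hv => hρρ (hρ v hv).1
    · exact fun v hv => treeU (tailT (hρ v hv).1)
    · intro u v hu hv huv
      obtain ⟨hz, hzv⟩ := hρ v hv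
      obtain ⟨h1, h2⟩ := entryU hz (fun h => hu ⟨_, hz, h⟩) hzv huv
      refine ⟨?_, h2, by rw [h2]; exact h1⟩
      have := (hα _ hz.1).mult_eq_one hs hG
      rwa [← h1, ← h2] at this
    · intro u v hu hv huv
      obtain ⟨hz, hzv⟩ := hρ v hv
      by_cases hzu : G.Dominates s (ρ v) u
      · exact hρU hz hzu
      · obtain ⟨h1, -⟩ := entryU hz hzu hzv huv
        exact absurd (h1 ▸ hu) (treeU (tailT hz))
    · intro v hv
      obtain ⟨hz, hzv⟩ := hρ v hv
      exact (hzv.reach_inside hs hG).weaken fun p q h => ⟨h.1, ⟨_, hz, h.2.1⟩, ⟨_, hz, h.2.2⟩⟩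
    · intro u v hu hne
      by_cases hvB : v ∈ B
      · rw [w₁_B hu hvB]
      by_cases huB : u ∈ B
      · rw [w₁_B' huB]
      rw [w₁_nB huB hvB, hw', aux_mult_eq hne]
      · show min 2 (G.mult u v) = _
        omega
      · intro p q hp hq hpq
        obtain ⟨huT, rfl⟩ := toT hu huB hp
        refine ⟨rfl, ?_⟩
        by_cases hvU : v ∈ U
        · obtain ⟨hz, hzq⟩ := toU hvU hq
          exact (entryU hz (hz.not_dominates huT hs hG) hzq hpq).2
        · exact (toT hvU hvB hq).2
      · intro huv
        have huT := mem_tree (G.left_mem huv) hu huB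
        refine ⟨shrinksTo_of_mem_tree huT, ?_⟩
        by_cases hvU : v ∈ U
        · obtain ⟨hz, hzv⟩ := hρ v hvU
          obtain ⟨-, h2⟩ := entryU hz (hz.not_dominates huT hs hG) hzv huv
          rw [← h2] at hz hzv
          exact hz.shrinksTo hzv
        · exact shrinksTo_of_mem_tree (mem_tree (G.right_mem huv) hvU hvB)
    · intro u v hu hv hne
      rw [w₁_nB (UB hu) (UB hv)]
      by_contra hn
      obtain ⟨-, p, q, hp, hq, hpq⟩ := aux_mult_pos_iff.1 (Nat.pos_of_ne_zero hn)
      obtain ⟨hcu, hup⟩ := toU hu hp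
      obtain ⟨hcv, hvq⟩ := toU hv hq
      by_cases hvp : G.Dominates s v p
      · exact hne (hcu.unique hcv hup hvp hs hG)
      · obtain ⟨rfl, -⟩ := entryU hcv hvp hvq hpq
        exact hcu.not_dominates (tailT hcv) hs hG hup
    · intro u v hu hv huv
      by_cases hvB : v ∈ B
      · exact (w₁_UB hu hvB).1 huv
      · rw [w₁_nB (UB hu) hvB] at huv
        obtain ⟨-, p, q, hp, hq, hpq⟩ := aux_mult_pos_iff.1 huv
        obtain ⟨hcu, hup⟩ := toU hu hp
        obtain ⟨-, rfl⟩ := toT hv hvB hq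
        exact ⟨(hρρ hcu).symm, p, ⟨u, hcu, hup⟩, hρU hcu hup, hpq⟩
    · intro u v hu hv huv _
      obtain ⟨hz, hzu⟩ := hρ u hu
      by_cases hvB : v ∈ B
      · exact (w₁_UB (childU hz) hvB).2 ⟨(hρρ hz).symm, u, hu, rfl, huv⟩
      · rw [w₁_nB (UB (childU hz)) hvB]
        refine aux_mult_pos_iff.2 ⟨?_, u, v, hz.shrinksTo hzu,
          shrinksTo_of_mem_tree (mem_tree (G.right_mem huv) hv hvB), huv⟩
        exact fun h => hv (h ▸ childU hz)
  have hc2 : ∃ e, IsContraction (fun u v => w₁ v u) (fun u v => w' v u) B (fun _ => e)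
      (fun _ => r) := by
    have agree : ∀ u v, u ∉ B → v ∈ B → min 2 (w v u) = min 2 (w' v u) := by
      intro u v hu hv
      have hne : v ≠ u := by
        rintro rfl
        exact hu hv
      obtain ⟨e, he⟩ := bridgeB hv
      rw [hw', aux_mult_eq hne]
      · show min 2 (G.mult v u) = _
        omega
      · intro p q hp hq hpq
        obtain ⟨rfl, hpB⟩ := toB he hv hp
        have hqB : q ∉ B := by
          by_cases huU : u ∈ U
          · obtain ⟨hz, hzq⟩ := toU huU hq
            exact UB ⟨_, hz, hzq⟩
          · rw [(toT huU hu hq).2]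
            exact hu
        obtain ⟨h1, rfl⟩ := he.entry hs hG hpB.2 (domB (G.right_mem hpq) hqB) hpq
        exact ⟨h1, (shrinksTo_of_mem_tree (root_mem_tree hs hG hrv)).unique hq hs hG⟩
      · intro hvu
        obtain ⟨rfl, rfl⟩ := he.entry hs hG hv.2 (domB (G.right_mem hvu) hu) hvu
        exact ⟨he.shrinksTo hs hG hv.1 hv.2, shrinksTo_of_mem_tree (root_mem_tree hs hG hrv)⟩
    have agree' : ∀ u v, u ∉ B → u ≠ v → min 2 (w₁ v u) = min 2 (w' v u) := by
      intro u v hu _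
      by_cases hv : v ∈ B
      · rw [w₁_B' hv]
        exact agree u v hu hv
      · rw [w₁_nB hv hu]
    by_cases hBe : ∃ b, b ∈ B
    swap
    · push Not at hBe
      -- There is nothing to contract, so the representative is arbitrary.
      exact ⟨r, fun v hv => absurd hv (hBe v), fun v hv => absurd hv (hBe v),
        fun v hv => absurd hv (hBe v), fun _ v _ hv => absurd hv (hBe v),
        fun _ v _ hv => absurd hv (hBe v), fun v hv => absurd hv (hBe v), agree',
        fun _ v _ hv => absurd hv (hBe v), fun v _ hv => absurd hv (hBe v),
        fun v _ hv => absurd hv (hBe v)⟩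
    obtain ⟨b, hb⟩ := hBe
    obtain ⟨e, he⟩ := bridgeB hb
    have heB : e ∈ B := ⟨G.left_mem he.1, he.not_dominates_tail hs hG⟩
    refine ⟨e, fun _ _ => heB, fun _ _ => rfl, fun _ _ h => h.2 hrr, ?_, fun _ _ _ _ _ => rfl,
      ?_, agree', ?_, ?_, ?_⟩
    · intro u v hu hv huv
      simp only [w₁_B' hv] at huv ⊢
      obtain ⟨rfl, rfl⟩ := he.entry hs hG hv.2 (domB (G.right_mem huv) hu) huv
      exact ⟨he.mult_eq_one hs hG, rfl, rfl⟩
    · intro v hv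
      have := (he.reach_outside hs hG hv.1 hv.2).swap
      refine this.weaken fun p q hpq => ?_
      have hpB : p ∈ B := ⟨G.right_mem hpq.1, hpq.2.2⟩
      have hqB : q ∈ B := ⟨G.left_mem hpq.1, hpq.2.1⟩
      exact ⟨by rw [w₁_B' hqB]; exact hpq.1, hpB, hqB⟩
    · intro u v hu hv hne
      by_contra hn
      obtain ⟨-, p, q, hp, hq, hpq⟩ := aux_mult_pos_iff.1 (Nat.pos_of_ne_zero hn)
      exact hne ((toB he hu hq).1.trans (toB he hv hp).1.symm)
    · intro u v hu hv huv
      obtain ⟨-, p, q, hp, hq, hpq⟩ := aux_mult_pos_iff.1 huv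
      obtain ⟨rfl, hqB⟩ := toB he hu hq
      refine ⟨rfl, q, hqB, rfl, ?_⟩
      by_cases hvU : v ∈ U
      · obtain ⟨hz, hzp⟩ := toU hvU hp
        exact (w₁_UB hvU hqB).2 ⟨(hρρ hz).symm, p, ⟨_, hz, hzp⟩, hρU hz hzp, hpq⟩
      · obtain ⟨-, rfl⟩ := toT hvU hv hp
        rw [w₁_B hvU hqB]
        exact hpq
    · intro u v hu hv huv _
      have hve : v ≠ e := fun h => hv (h ▸ heB)
      by_cases hvU : v ∈ U
      · obtain ⟨h1, u', hu', h2, h3⟩ := (w₁_UB hvU hu).1 huv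
        obtain ⟨hz, hzu⟩ := hρ u' hu'
        rw [h2] at hz hzu
        exact aux_mult_pos_iff.2 ⟨hve, u', u, hz.shrinksTo hzu, he.shrinksTo hs hG hu.1 hu.2, h3⟩
      · rw [w₁_B hvU hu] at huv
        exact aux_mult_pos_iff.2 ⟨hve, v, u,
          shrinksTo_of_mem_tree (mem_tree (G.left_mem huv) hvU hv),
          he.shrinksTo hs hG hu.1 hu.2, huv⟩
  obtain ⟨e, hc2⟩ := hc2
  rw [hc1.twoEdgeLinked_iff (treeU hx) (treeU hy), ← twoEdgeLinked_swap (w := w₁),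
    hc2.twoEdgeLinked_iff (treeB hx) (treeB hy), twoEdgeLinked_swap]

theorem tree_subset_aux : G.tree s r ⊆ (G.aux s r).verts := fun _ h => Or.inl (Or.inl h)

theorem twoEdgeTwinlessConn_aux (hs : s ∈ G.verts) (hG : G.StronglyConnected)
    (hr : r = s ∨ G.Marked s r) {x y : V} (hx : x ∈ G.tree s r) (hy : y ∈ G.tree s r) :
    (G.aux s r).TwoEdgeTwinlessConn x y ↔ G.TwoEdgeTwinlessConn x y := by
  rw [hG.twoEdgeTwinlessConn_iff hx.1.2.1 hy.1.2.1, twoEdgeLinked_aux hs hG hr hx hy,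
    (hG.aux hs hr).twoEdgeTwinlessConn_iff (tree_subset_aux hx) (tree_subset_aux hy)]

theorem TwoEdgeTwinlessConn.exists_tree (hs : s ∈ G.verts) (hG : G.StronglyConnected) {x y : V}
    (h : G.TwoEdgeTwinlessConn x y) :
    ∃ r, (r = s ∨ G.Marked s r) ∧ x ∈ G.tree s r ∧ y ∈ G.tree s r := by
  obtain ⟨hx, hy⟩ := h.mem_verts
  obtain ⟨r, hr, hxr⟩ := exists_mem_tree hs hG hx
  exact ⟨r, hr, hxr,
    TwoEdgeLinked.mem_tree hs hG hy ((hG.twoEdgeTwinlessConn_iff hx hy).1 h) hr hxr⟩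

theorem StronglyConnected.twoEdgeTwinlessConn_reverse (hG : G.StronglyConnected) {x y : V}
    (hx : x ∈ G.verts) (hy : y ∈ G.verts) :
    G.reverse.TwoEdgeTwinlessConn x y ↔ G.TwoEdgeTwinlessConn x y := by
  rw [hG.twoEdgeTwinlessConn_iff hx hy, hG.reverse.twoEdgeTwinlessConn_iff hx hy]
  exact twoEdgeLinked_swap

end Auxiliary

end MultiDigraph

namespace MultiDigraph

/-! ### The S-operation preserves the relation inside a component. -/

section SplitComponents

variable {V : Type*}

theorem TwoEdgeLinked.symm {w : V → V → ℕ} {x y : V} (h : TwoEdgeLinked w x y) :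
    TwoEdgeLinked w y x :=
  ⟨h.1.symm, fun p q hpq => (h.2 p q hpq).symm⟩

theorem IsSCC.reach {G C : MultiDigraph V} (h : G.IsSCC C) {u v : V} (hu : u ∈ C.verts)
    (hv : v ∈ C.verts) : ReflTransGen G.Adj u v :=
  (StronglyConnected.reach h.1.2 hu hv).weaken fun p q hpq => Nat.lt_of_lt_of_le hpq (h.1.1.2 p q)

/-- The vertices mutually reachable with `u` induce a strongly connected subgraph containing `C`, so
maximality puts all of them in `C`. -/
theorem IsSCC.mem_of_reach {G C : MultiDigraph V} (h : G.IsSCC C) {u v : V} (hu : u ∈ C.verts)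
    (huv : ReflTransGen G.Adj u v) (hvu : ReflTransGen G.Adj v u) : v ∈ C.verts := by
  classical
  let W : Set V := {m | ReflTransGen G.Adj u m ∧ ReflTransGen G.Adj m u}
  let H : MultiDigraph V :=
    { verts := W
      mult := fun p q => if p ∈ W ∧ q ∈ W then G.mult p q else 0
      left_mem := fun {p q} hpq => by
        by_contra hn
        simp [hn] at hpq
      right_mem := fun {p q} hpq => by
        by_contra hn
        simp [hn] at hpq }
  have hHG : H ≤ G := by
    refine ⟨fun m hm => mem_verts_of_reach (h.1.1.1 hu) hm.1, fun p q => ?_⟩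
    show (if p ∈ W ∧ q ∈ W then G.mult p q else 0) ≤ _
    split_ifs
    · exact le_rfl
    · exact Nat.zero_le _
  have hHs : H.StronglyConnected := by
    intro p hp q hq
    refine Reaches.iff_reflTransGen.2 ⟨hp, ?_⟩
    refine (reflTransGen_restrict (hp.2.trans hq.1) (W := W) fun m h1 h2 =>
      ⟨hp.1.trans h1, h2.trans hq.2⟩).weaken fun c d hcd => ?_
    show 0 < (if c ∈ W ∧ d ∈ W then G.mult c d else 0)
    rw [if_pos hcd.2]
    exact hcd.1
  have hCH : C ≤ H := by
    have hCW : C.verts ⊆ W := fun m hm => ⟨h.reach hu hm, h.reach hm hu⟩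
    refine ⟨hCW, fun p q => ?_⟩
    rcases Nat.eq_zero_or_pos (C.mult p q) with h0 | h0
    · rw [h0]
      exact Nat.zero_le _
    · show _ ≤ (if p ∈ W ∧ q ∈ W then G.mult p q else 0)
      rw [if_pos ⟨hCW (C.left_mem h0), hCW (C.right_mem h0)⟩]
      exact h.1.1.2 p q
  exact (h.2 ⟨hHG, hHs⟩ hCH).1 ⟨huv, hvu⟩

theorem exists_isSCC [Finite V] {G : MultiDigraph V} {x : V} (hx : x ∈ G.verts) :
    ∃ C, G.IsSCC C ∧ x ∈ C.verts := by
  let H : MultiDigraph V :=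
    { verts := {x}
      mult := fun _ _ => 0
      left_mem := fun h => absurd h (lt_irrefl 0)
      right_mem := fun h => absurd h (lt_irrefl 0) }
  obtain ⟨C, hHC, hC⟩ := exists_le_maximal G StronglyConnected (H := H)
    ⟨⟨Set.singleton_subset_iff.2 hx, fun _ _ => Nat.zero_le _⟩, by
      intro u hu v hv
      rw [show u = x from hu, show v = x from hv]
      exact ⟨_, .single (Set.mem_singleton x)⟩⟩
  exact ⟨C, hC, hHC.1 rfl⟩

variable [Fintype V] {K : MultiDigraph V} {a b : V}

theorem sGraph_mult_pos {C : Set V} {p q : V} (h : 0 < (K.sGraph a b C).mult p q) :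
    (p ∈ C ∧ q ∈ C) ∨ (p ∈ C ∧ q = a ∧ ∃ m, m ∉ C ∧ 0 < K.mult p m) ∨
      (p = b ∧ q ∈ C ∧ ∃ m, m ∉ C ∧ 0 < K.mult m q) ∨ (p = a ∧ q = b) := by
  classical
  by_contra! hn
  obtain ⟨h1, h2, h3, h4⟩ := hn
  have e1 : ¬ (p ∈ C ∧ q ∈ C) := fun h => h1 h.1 h.2
  have e4 : ¬ (p = a ∧ q = b) := fun h => h4 h.1 h.2
  refine absurd h ?_
  simp only [sGraph, if_neg e1, if_neg e4, zero_add, add_zero, not_lt, nonpos_iff_eq_zero,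
    Nat.add_eq_zero_iff]
  constructor
  · split_ifs with h5
    · refine Finset.sum_eq_zero fun m _ => ?_
      split_ifs with h6
      · rfl
      · exact Nat.le_zero.1 (h2 h5.1 h5.2 m h6)
    · rfl
  · split_ifs with h5
    · refine Finset.sum_eq_zero fun m _ => ?_
      split_ifs with h6
      · rfl
      · exact Nat.le_zero.1 (h3 h5.1 h5.2 m h6)
    · rfl

theorem sGraph_mult_pos_left {C : Set V} {p m : V} (hp : p ∈ C) (hm : m ∉ C)
    (h : 0 < K.mult p m) : 0 < (K.sGraph a b C).mult p a := by
  classical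
  have : 0 < ∑ w : V, (if w ∉ C then K.mult p w else 0) :=
    Finset.sum_pos_iff.2 ⟨m, Finset.mem_univ _, by rwa [if_pos hm]⟩
  simp only [sGraph, hp, true_and, if_true]
  omega

theorem sGraph_mult_pos_right {C : Set V} {q m : V} (hq : q ∈ C) (hm : m ∉ C)
    (h : 0 < K.mult m q) : 0 < (K.sGraph a b C).mult b q := by
  classical
  have : 0 < ∑ w : V, (if w ∉ C then K.mult w q else 0) :=
    Finset.sum_pos_iff.2 ⟨m, Finset.mem_univ _, by rwa [if_pos hm]⟩
  simp only [sGraph, hq, and_true, if_true]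
  omega

theorem sGraph_mult_eq {C : Set V} {p q : V} (hpC : p ∈ C) (hqC : q ∈ C)
    (h1 : q = a → ∀ m, m ∉ C → K.mult p m = 0) (h2 : p = b → ∀ m, m ∉ C → K.mult m q = 0)
    (h3 : ¬ (p = a ∧ q = b)) : (K.sGraph a b C).mult p q = K.mult p q := by
  classical
  simp only [sGraph, if_neg h3, hpC, hqC, and_self, if_true, true_and, and_true, add_zero]
  have e1 : (if q = a then ∑ w : V, (if w ∉ C then K.mult p w else 0) else 0) = 0 := by
    split_ifs with h
    · refine Finset.sum_eq_zero fun m _ => ?_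
      split_ifs with h6
      · rfl
      · exact h1 h m h6
    · rfl
  have e2 : (if p = b then ∑ w : V, (if w ∉ C then K.mult w q else 0) else 0) = 0 := by
    split_ifs with h
    · refine Finset.sum_eq_zero fun m _ => ?_
      split_ifs with h6
      · rfl
      · exact h2 h m h6
    · rfl
  rw [e1, e2, add_zero, add_zero]

theorem sGraph_mult_self {C : Set V} (h : ¬ (a ∈ C ∧ b ∈ C)) (hab : a ≠ b) :
    (K.sGraph a b C).mult a b = 1 := by
  classical
  have h1 : ¬ (a ∈ C ∧ b = a) := fun h => hab h.2.symm
  have h2 : ¬ (a = b ∧ b ∈ C) := fun h => hab h.1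
  simp [sGraph, h, h1, h2]

/-- Outside the component, `P` collects the vertices that reach it without `(a, b)` and `Q` the
others. Then `Q` is contracted into `a` in the reversed graph and `P` into `b`. By `hnr`, `a` and
`b` are not both in the component, so the added edge `(a, b)` is simple. -/
theorem twoEdgeLinked_sGraph (hK : K.StronglyConnected) (hab : K.mult a b = 1)
    (hnr : ¬ ReflTransGen (dropEdge K.Adj a b) a b) {C : MultiDigraph V}
    (hC : (K.deleteEdge a b).IsSCC C) {x y : V} (hx : x ∈ C.verts) (hy : y ∈ C.verts) :
    TwoEdgeLinked K.mult x y ↔ TwoEdgeLinked (K.sGraph a b C.verts).mult x y := by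
  classical
  have hE : (K.deleteEdge a b).Adj = dropEdge K.Adj a b := adj_deleteEdge_of_le_one K hab.le
  set E := dropEdge K.Adj a b with hEdef
  set S := C.verts with hS
  have conn : ∀ {u v}, u ∈ S → v ∈ S → ReflTransGen E u v := fun hu hv => hE ▸ hC.reach hu hv
  have closed : ∀ {u v}, u ∈ S → ReflTransGen E u v → ReflTransGen E v u → v ∈ S :=
    fun hu huv hvu => hC.mem_of_reach hu (by rwa [hE]) (by rwa [hE])
  have hSv : ∀ {v}, v ∈ S → v ∈ K.verts := fun hv => hC.1.1.1 hv
  have hadj : K.Adj a b := by rw [Adj, hab]; exact one_pos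
  have hav : a ∈ K.verts := K.left_mem hadj
  have hbv : b ∈ K.verts := K.right_mem hadj
  have hne : a ≠ b := by
    rintro rfl
    exact hnr .refl
  -- A path from `b` that uses `(a, b)` returns to `b` by doing so and can be shortened; dually, a
  -- path to `a` can stop before its first use of `(a, b)`.
  have fromb : ∀ {v}, v ∈ K.verts → ReflTransGen E b v := fun hv =>
    (reflTransGen_dropEdge_or a b (hK.reach hbv hv)).elim id fun h => h.2
  have toa : ∀ {v}, v ∈ K.verts → ReflTransGen E v a := fun hv =>
    (reflTransGen_dropEdge_or a b (hK.reach hv hav)).elim id fun h => h.1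
  set P : Set V := {v | v ∉ S ∧ ∃ c ∈ S, ReflTransGen E v c} with hP
  set Q : Set V := {v | v ∈ K.verts ∧ v ∉ S ∧ v ∉ P} with hQ
  have edge : ∀ {u v}, K.Adj u v → (u = a ∧ v = b) ∨ E u v := fun {u v} huv => by
    by_cases h : u = a ∧ v = b
    · exact Or.inl h
    · exact Or.inr ⟨huv, h⟩
  have pathP : ∀ {u v}, ReflTransGen E u v → v ∈ P → u ∈ P := by
    rintro u v huv ⟨hv, c, hc, hvc⟩
    exact ⟨fun hu => hv (closed hu huv (hvc.trans (conn hc hu))), c, hc, huv.trans hvc⟩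
  have edgeQ : ∀ {u v}, E u v → u ∈ Q → v ∈ Q := by
    rintro u v huv ⟨hu, huS, huP⟩
    exact ⟨K.right_mem huv.1, fun hv => huP ⟨huS, v, hv, .single huv⟩,
      fun hv => huP (pathP (.single huv) hv)⟩
  have haQ : ∀ {v}, v ∈ Q → a ∈ Q := fun {v} hv =>
    mem_of_reflTransGen (fun _ hp _ hpq => edgeQ hpq hp) (toa hv.1) hv
  have hbP : ∀ {v}, v ∈ P → b ∈ P := fun {v} hv =>
    pathP (fromb (by
      obtain ⟨-, c, hc, hvc⟩ := hv
      rcases hvc.cases_head with rfl | ⟨d, hd, -⟩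
      · exact hSv hc
      · exact K.left_mem hd.1)) hv
  have haP : a ∉ P := by
    rintro ⟨h, c, hc, hac⟩
    exact h (closed hc (toa (hSv hc)) hac)
  have hbQ : b ∉ Q := fun h => h.2.2 ⟨h.2.1, x, hx, fromb (hSv hx)⟩
  have haSQ : a ∉ S → a ∈ Q := fun h => ⟨hav, h, haP⟩
  have hbSP : b ∉ S → b ∈ P := fun h => ⟨h, x, hx, fromb (hSv hx)⟩
  have hPS : ∀ {v}, v ∈ P → v ∉ S := fun h => h.1
  have hQS : ∀ {v}, v ∈ Q → v ∉ S := fun h => h.2.1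
  have hQP : ∀ {v}, v ∈ Q → v ∉ P := fun h => h.2.2
  have mem_S : ∀ {v}, v ∈ K.verts → v ∉ P → v ∉ Q → v ∈ S := fun hv hvP hvQ => by
    by_contra h
    exact hvQ ⟨hv, h, hvP⟩
  set w := K.mult with hw
  set w' := (K.sGraph a b S).mult with hw'
  have same : ∀ {p q}, p ∉ P → q ∉ Q → p ≠ q → w p q = w' p q := by
    intro p q hp hq hpq
    by_cases he : p = a ∧ q = b
    · obtain ⟨rfl, rfl⟩ := he
      rw [hab, hw', sGraph_mult_self (fun h => hnr (conn h.1 h.2)) hne]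
    by_cases hS2 : p ∈ S ∧ q ∈ S
    · refine (sGraph_mult_eq hS2.1 hS2.2 ?_ ?_ he).symm
      · rintro rfl m hm
        by_contra h0
        have hpm : E p m := (edge (Nat.pos_of_ne_zero h0)).resolve_left fun h => hpq h.1
        by_cases hmP : m ∈ P
        · exact hp (pathP (.single hpm) hmP)
        · exact hq (haQ ⟨K.right_mem hpm.1, hm, hmP⟩)
      · rintro rfl m hm
        by_contra h0
        have hmq : E m q := (edge (Nat.pos_of_ne_zero h0)).resolve_left fun h => hpq h.2.symm
        exact hp (hbP ⟨hm, q, hS2.2, .single hmq⟩)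
    · have h0 : w p q = 0 := by
        by_contra h0
        have h0 := Nat.pos_of_ne_zero h0
        have hE := (edge h0).resolve_left he
        have hqP : q ∉ P := fun h => hp (pathP (.single hE) h)
        have hpQ : p ∉ Q := fun h => hq (edgeQ hE h)
        exact hS2 ⟨mem_S (K.left_mem h0) hp hpQ, mem_S (K.right_mem h0) hqP hq⟩
      rw [h0]
      by_contra h1
      rcases sGraph_mult_pos (Nat.pos_of_ne_zero (Ne.symm h1)) with h | ⟨h2, rfl, -⟩ |
        ⟨rfl, h2, -⟩ | h
      · exact hS2 h
      · exact hq (haSQ fun h => hS2 ⟨h2, h⟩)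
      · exact hp (hbSP fun h => hS2 ⟨h, h2⟩)
      · exact he h
  -- The stage where only `Q` is contracted. For edges from `P` into `Q` mere presence is kept, and
  -- they are redirected to `a`.
  set w₁ : V → V → ℕ := fun u v =>
    if u ∈ P then (if v ∈ Q then (if v = a ∧ ∃ v' ∈ Q, 0 < w u v' then 1 else 0) else w u v)
    else w' u v with hw₁
  have w₁_P : ∀ {u v}, u ∈ P → v ∉ Q → w₁ u v = w u v := fun hu hv => by
    simp only [hw₁, if_pos hu, if_neg hv]
  have w₁_PQ : ∀ {u v}, u ∈ P → v ∈ Q → (0 < w₁ u v ↔ v = a ∧ ∃ v' ∈ Q, 0 < w u v') := by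
    intro u v hu hv
    simp only [hw₁, if_pos hu, if_pos hv]
    split_ifs with h
    · exact iff_of_true one_pos h
    · exact iff_of_false (lt_irrefl 0) h
  have w₁_nP : ∀ {u v}, u ∉ P → w₁ u v = w' u v := fun hu => by
    simp only [hw₁, if_neg hu]
  have hc1 : IsContraction (fun u v => w v u) (fun u v => w₁ v u) Q (fun _ => a)
      (fun _ => b) := by
    refine ⟨fun v hv => haQ hv, fun _ _ => rfl, fun _ _ => hbQ, ?_, fun _ _ _ _ _ => rfl, ?_,
      ?_, ?_, ?_, ?_⟩
    · intro u v hu hv huv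
      rcases edge huv with ⟨rfl, rfl⟩ | h
      · exact ⟨hab, rfl, rfl⟩
      · exact absurd (edgeQ h hv) hu
    · intro v hv
      refine (reflTransGen_restrict (W := Q) (toa hv.1) fun m hm _ => mem_of_reflTransGen
        (fun _ hp _ hpq => edgeQ hpq hp) hm hv).swap.weaken fun p q hpq => ?_
      exact ⟨hpq.1.1, hpq.2.2, hpq.2.1⟩
    · intro u v hu huv
      show min 2 (w v u) = min 2 (w₁ v u)
      by_cases hv : v ∈ P
      · rw [w₁_P hv hu]
      · rw [w₁_nP hv, same hv hu huv.symm]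
    · intro u v hu hv huv
      show w₁ v u = 0
      rw [w₁_nP (hQP hv)]
      by_contra h0
      rcases sGraph_mult_pos (Nat.pos_of_ne_zero h0) with h | h | h | h
      · exact hQS hv h.1
      · exact hQS hv h.1
      · exact hQS hu h.2.1
      · exact hbQ (h.2 ▸ hu)
    · intro u v hu hv huv
      by_cases hvP : v ∈ P
      · obtain ⟨rfl, v', hv', h⟩ := (w₁_PQ hvP hu).1 huv
        exact ⟨rfl, v', hv', rfl, h⟩
      · have huv : 0 < w' v u := by
          rw [← w₁_nP hvP]
          exact huv
        rcases sGraph_mult_pos huv with h | ⟨h1, rfl, m, hm, hvm⟩ | h | h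
        · exact absurd h.2 (hQS hu)
        · refine ⟨rfl, m, ⟨K.right_mem hvm, hm, fun hmP => ?_⟩, rfl, hvm⟩
          rcases edge hvm with ⟨rfl, -⟩ | h
          · exact hv hu
          · exact hvP (pathP (.single h) hmP)
        · exact absurd h.2.1 (hQS hu)
        · exact absurd (h.2 ▸ hu) hbQ
    · intro u v hu hv huv _
      show 0 < w₁ v a
      by_cases hvP : v ∈ P
      · exact (w₁_PQ hvP (haQ hu)).2 ⟨rfl, u, hu, huv⟩
      · rw [w₁_nP hvP]
        exact sGraph_mult_pos_left (mem_S (K.left_mem huv) hvP hv) (hQS hu) huv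
  have hc2 : IsContraction w₁ w' P (fun _ => b) (fun _ => a) := by
    refine ⟨fun v hv => hbP hv, fun _ _ => rfl, fun _ _ => haP, ?_, fun _ _ _ _ _ => rfl, ?_,
      ?_, ?_, ?_, ?_⟩
    · intro u v hu hv huv
      rw [w₁_nP hu] at huv ⊢
      have h := same hu (fun h => hQP h hv) (by rintro rfl; exact hu hv)
      rw [← h] at huv ⊢
      rcases edge huv with ⟨rfl, rfl⟩ | h
      · exact ⟨hab, rfl, rfl⟩
      · exact absurd (pathP (.single h) hv) hu
    · intro v hv
      have hb := hbP hv
      have hvv : v ∈ K.verts := by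
        obtain ⟨-, c, hc, hvc⟩ := hv
        rcases hvc.cases_head with rfl | ⟨d, hd, -⟩
        · exact hSv hc
        · exact K.left_mem hd.1
      refine (reflTransGen_restrict (W := P) (fromb hvv) fun m _ hm => pathP hm hv).weaken
        fun p q hpq => ⟨?_, hpq.2⟩
      rw [w₁_P hpq.2.1 fun h => hQP h hpq.2.2]
      exact hpq.1.1
    · intro u v hu _
      rw [w₁_nP hu]
    · intro u v hu hv _
      by_contra h0
      rcases sGraph_mult_pos (Nat.pos_of_ne_zero h0) with h | h | h | h
      · exact hPS hu h.1
      · exact hPS hu h.1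
      · exact hPS hv h.2.1
      · exact haP (h.1 ▸ hu)
    · intro u v hu hv huv
      rcases sGraph_mult_pos huv with h | h | ⟨rfl, h1, m, hm, hmv⟩ | h
      · exact absurd h.1 (hPS hu)
      · exact absurd h.1 (hPS hu)
      · rcases edge hmv with ⟨-, rfl⟩ | h
        · exact absurd hu hv
        · have hmP : m ∈ P := ⟨hm, v, h1, .single h⟩
          refine ⟨rfl, m, hmP, rfl, ?_⟩
          rw [w₁_P hmP fun h => hQS h h1]
          exact hmv
      · exact absurd (h.1 ▸ hu) haP
    · intro u v hu hv huv hva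
      by_cases hvQ : v ∈ Q
      · exact absurd ((w₁_PQ hu hvQ).1 huv).1 hva
      · rw [w₁_P hu hvQ] at huv
        exact sGraph_mult_pos_right (mem_S (K.right_mem huv) hv hvQ) (hPS hu) huv
  have hxQ := fun h => hQS h hx
  have hyQ := fun h => hQS h hy
  have hxP := fun h => hPS h hx
  have hyP := fun h => hPS h hy
  rw [← twoEdgeLinked_swap, hc1.twoEdgeLinked_iff hxQ hyQ, twoEdgeLinked_swap,
    hc2.twoEdgeLinked_iff hxP hyP]

/-- If `b` lies outside the component, the simple edge `(a, b)` is its only entry, so deleting it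
isolates `b` from incoming paths. This matters because `b` is a vertex of every graph of the
S-operation. -/
theorem not_twoEdgeLinked_sGraph {C : Set V} {y : V} (hab : a ≠ b) (hb : b ∉ C) (hy : y ≠ b) :
    ¬ TwoEdgeLinked (K.sGraph a b C).mult b y := by
  intro h
  have h1 := sGraph_mult_self (K := K) (fun h : a ∈ C ∧ b ∈ C => hb h.2) hab
  rcases (h.2 a b h1.le).bwd.cases_tail with h2 | ⟨c, -, hc⟩
  · exact hy h2.symm
  · rcases sGraph_mult_pos hc.1 with h | h | h | h
    · exact hb h.2
    · exact hab h.2.1.symm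
    · exact hb h.2.1
    · exact hc.2 h

/-- The operation `S(K, (a, b))` preserves the 2-edge twinless strongly connected pairs. -/
theorem twoEdgeTwinlessConn_iff_exists_sOp (hK : K.StronglyConnected) (hab : K.mult a b = 1)
    (hnr : ¬ ReflTransGen (dropEdge K.Adj a b) a b) {x y : V} (hx : x ∈ K.verts)
    (hy : y ∈ K.verts) (hxa : x ≠ a) (hya : y ≠ a) :
    (∃ A ∈ K.sOp a b, x ∈ A.verts ∧ y ∈ A.verts ∧ A.TwoEdgeTwinlessConn x y) ↔
      K.TwoEdgeTwinlessConn x y := by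
  have hne : a ≠ b := by
    rintro rfl
    exact hnr .refl
  have hE : (K.deleteEdge a b).Adj = dropEdge K.Adj a b := adj_deleteEdge_of_le_one K hab.le
  rw [hK.twoEdgeTwinlessConn_iff hx hy]
  have edge : ∀ {C}, (K.deleteEdge a b).IsSCC C →
      (K.sGraph a b C.verts).mult a b = 1 := fun hC =>
    sGraph_mult_self (fun h => hnr (hE ▸ hC.reach h.1 h.2)) hne
  constructor
  · rintro ⟨A, ⟨C, hC, rfl⟩, hxA, hyA, h⟩
    rw [twoEdgeTwinlessConn_iff hxA hyA fun _ => ⟨a, b, by rw [edge hC]; exact one_pos⟩] at h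
    rcases eq_or_ne x y with rfl | hxy
    · exact .refl _ _
    have mem : ∀ z ∈ (K.sGraph a b C.verts).verts, z ≠ a → z ∉ C.verts → z = b := by
      rintro z (hz | rfl | rfl) hza hzC
      · exact absurd hz hzC
      · exact absurd rfl hza
      · rfl
    have hxC : x ∈ C.verts := by
      by_contra hn
      obtain rfl := mem x hxA hxa hn
      exact not_twoEdgeLinked_sGraph hne hn hxy.symm h
    have hyC : y ∈ C.verts := by
      by_contra hn
      obtain rfl := mem y hyA hya hn
      exact not_twoEdgeLinked_sGraph hne hn hxy h.symm
    exact (twoEdgeLinked_sGraph hK hab hnr hC hxC hyC).2 h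
  · intro h
    obtain ⟨C, hC, hxC⟩ := exists_isSCC (G := K.deleteEdge a b) hx
    -- Deleting `(a, b)` itself leaves `x` and `y` mutually reachable, so one component contains
    -- both.
    have hl := h.2 a b hab.le
    have hyC : y ∈ C.verts := hC.mem_of_reach hxC (hE ▸ hl.fwd) (hE ▸ hl.bwd)
    have hxA : x ∈ (K.sGraph a b C.verts).verts := Or.inl hxC
    have hyA : y ∈ (K.sGraph a b C.verts).verts := Or.inl hyC
    refine ⟨_, ⟨C, hC, rfl⟩, hxA, hyA, ?_⟩
    rw [twoEdgeTwinlessConn_iff hxA hyA fun _ => ⟨a, b, by rw [edge hC]; exact one_pos⟩]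
    exact (twoEdgeLinked_sGraph hK hab hnr hC hxC hyC).1 h

end SplitComponents

/-! ### Composition of the two auxiliary constructions and the S-operation. -/

section Main

variable {V : Type*} {G : MultiDigraph V} {s r : V}

theorem root_mem_verts (hs : s ∈ G.verts) (hr : r = s ∨ G.Marked s r) : r ∈ G.verts :=
  hr.elim (fun h => h ▸ hs) Marked.mem_verts

variable [Fintype V]

/-- In `H(G_s, r)` the vertex `d(r)` has a single outgoing edge, which leads to `r`. -/
theorem IsBridge.aux_edge {e : V} (h : G.IsBridge s e r) (hs : s ∈ G.verts)
    (hG : G.StronglyConnected) :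
    (G.aux s r).mult e r = 1 ∧ ∀ v, 0 < (G.aux s r).mult e v → v = r := by
  have hrv := G.right_mem h.1
  have hev := G.left_mem h.1
  have her := h.not_dominates_tail hs hG
  have hr := shrinksTo_of_mem_tree (root_mem_tree hs hG hrv)
  have key : ∀ u v p, v ≠ e → G.ShrinksTo s r u e → G.ShrinksTo s r p v → 0 < G.mult u p →
      u = e ∧ v = r ∧ p = r := by
    intro u v p hve hu hp hup
    have hu' : ¬ G.Dominates s r u := by
      rcases shrinksTo_cases hu with ⟨h1, rfl⟩ | ⟨h1, -⟩ | h1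
      · exact absurd h1.1 her
      · exact absurd (h1.dominates hs) her
      · exact h1.2.2.2
    have hp' : G.Dominates s r p := by
      by_contra hn
      exact hve (hp.unique (h.shrinksTo hs hG hp.mem_verts hn) hs hG)
    obtain ⟨h1, rfl⟩ := h.entry hs hG hu' hp' hup
    exact ⟨h1, hp.unique hr hs hG, rfl⟩
  have hne : e ≠ r := (h.isIdom hs hG).2.1
  constructor
  · rw [aux_mult_eq hne]
    · rw [h.mult_eq_one hs hG]
      rfl
    · intro u v hu hv huv
      obtain ⟨h1, -, h2⟩ := key u r v hne.symm hu hv huv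
      exact ⟨h1, h2⟩
    · exact fun _ => ⟨h.shrinksTo hs hG hev her, hr⟩
  · intro v hv
    obtain ⟨h1, u, p, hu, hp, hup⟩ := aux_mult_pos_iff.1 hv
    exact (key u v p h1.symm hu hp hup).2.1

theorem IsBridge.aux_not_reach {e : V} (h : G.IsBridge s e r) (hs : s ∈ G.verts)
    (hG : G.StronglyConnected) : ¬ ReflTransGen (dropEdge (G.aux s r).Adj e r) e r := by
  intro hn
  rcases hn.cases_head with h1 | ⟨c, hc, -⟩
  · exact (h.isIdom hs hG).2.1 h1
  · exact hc.2 ⟨rfl, (h.aux_edge hs hG).2 c hc.1⟩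

/-- The S-operation applies because the simple edge into `r` is the only one that leaves `d(r)` in
the auxiliary graph; vertices of `T(r)` differ from `d(r)`, which `r` does not dominate. -/
theorem twoEdgeTwinlessConn_aux_iff_exists_sOp {d : V} (hs : s ∈ G.verts)
    (hG : G.StronglyConnected) (hr : G.Marked s r) (hd : G.IsIdom s d r) {x y : V}
    (hx : x ∈ G.tree s r) (hy : y ∈ G.tree s r) :
    (∃ A ∈ (G.aux s r).sOp d r, x ∈ A.verts ∧ y ∈ A.verts ∧ A.TwoEdgeTwinlessConn x y) ↔
      (G.aux s r).TwoEdgeTwinlessConn x y := by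
  obtain ⟨e, he⟩ := hr
  obtain rfl := he.eq_of_isIdom hd hs hG
  have hne : ∀ {z}, z ∈ G.tree s r → z ≠ d := by
    rintro z hz rfl
    exact he.not_dominates_tail hs hG hz.1
  exact twoEdgeTwinlessConn_iff_exists_sOp (hG.aux hs (Or.inr ⟨d, he⟩)) (he.aux_edge hs hG).1
    (he.aux_not_reach hs hG) (tree_subset_aux hx) (tree_subset_aux hy) (hne hx) (hne hy)

theorem root_mem_auxOne_reverse (hs : s ∈ G.verts) (hG : G.StronglyConnected)
    (hr : r = s ∨ G.Marked s r) : r ∈ (G.auxOne s r).reverse.verts :=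
  tree_subset_aux (root_mem_tree hs hG (root_mem_verts hs hr))

theorem stronglyConnected_auxOne_reverse (hs : s ∈ G.verts) (hG : G.StronglyConnected)
    (hr : r = s ∨ G.Marked s r) : (G.auxOne s r).reverse.StronglyConnected :=
  (hG.aux hs hr).reverse

theorem twoEdgeTwinlessConn_auxTwo (hs : s ∈ G.verts) (hG : G.StronglyConnected)
    (hr : r = s ∨ G.Marked s r) {r' : V} (hr' : r' = r ∨ (G.auxOne s r).reverse.Marked r r')
    {x y : V} (hx : x ∈ G.oo s r r') (hy : y ∈ G.oo s r r') :
    (G.auxTwo s r r').TwoEdgeTwinlessConn x y ↔ G.TwoEdgeTwinlessConn x y := by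
  rw [← twoEdgeTwinlessConn_aux hs hG hr hx.1 hy.1,
    ← (hG.aux hs hr).twoEdgeTwinlessConn_reverse (tree_subset_aux hx.1) (tree_subset_aux hy.1)]
  exact twoEdgeTwinlessConn_aux (root_mem_auxOne_reverse hs hG hr)
    (stronglyConnected_auxOne_reverse hs hG hr) hr' hx.2 hy.2

theorem exists_sOp_auxTwo_iff (hs : s ∈ G.verts) (hG : G.StronglyConnected)
    (hr : r = s ∨ G.Marked s r) {r' d : V} (hr' : (G.auxOne s r).reverse.Marked r r')
    (hd : (G.auxOne s r).reverse.IsIdom r d r')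
    {x y : V} (hx : x ∈ G.oo s r r') (hy : y ∈ G.oo s r r') :
    (∃ A ∈ (G.auxTwo s r r').sOp d r',
      x ∈ A.verts ∧ y ∈ A.verts ∧ A.TwoEdgeTwinlessConn x y) ↔ G.TwoEdgeTwinlessConn x y := by
  rw [← twoEdgeTwinlessConn_auxTwo hs hG hr (Or.inr hr') hx hy]
  exact twoEdgeTwinlessConn_aux_iff_exists_sOp (root_mem_auxOne_reverse hs hG hr)
    (stronglyConnected_auxOne_reverse hs hG hr) hr' hd hx.2 hy.2

/-- The tree argument is used twice: in `G`, and then in the reverse of `H_r`, to which the relation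
has been transferred. -/
theorem TwoEdgeTwinlessConn.exists_oo (hs : s ∈ G.verts) (hG : G.StronglyConnected) {x y : V}
    (h : G.TwoEdgeTwinlessConn x y) :
    ∃ r r', (r = s ∨ G.Marked s r) ∧ (r' = r ∨ (G.auxOne s r).reverse.Marked r r') ∧
      x ∈ G.oo s r r' ∧ y ∈ G.oo s r r' := by
  obtain ⟨r, hr, hx, hy⟩ := h.exists_tree hs hG
  have h1 := (twoEdgeTwinlessConn_aux hs hG hr hx hy).2 h
  have h2 := ((hG.aux hs hr).twoEdgeTwinlessConn_reverse (tree_subset_aux hx)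
    (tree_subset_aux hy)).2 h1
  obtain ⟨r', hr', hx', hy'⟩ := h2.exists_tree (root_mem_auxOne_reverse hs hG hr)
    (stronglyConnected_auxOne_reverse hs hG hr)
  exact ⟨r, r', hr, hr', ⟨hx, hx'⟩, ⟨hy, hy'⟩⟩

end Main

end MultiDigraph

theorem mainTheorem7 {V : Type*} [Fintype V] (G : MultiDigraph V) (s : V) (hs : s ∈ G.verts)
    (hG : G.StronglyConnected) (x y : V) (hx : x ∈ G.verts) (hy : y ∈ G.verts) :
    G.TwoEdgeTwinlessConn x y ↔
      -- `H_{ss}`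
      (x ∈ G.oo s s s ∧ y ∈ G.oo s s s ∧ (G.auxTwo s s s).TwoEdgeTwinlessConn x y) ∨
      -- `H_{rr}` for a marked vertex `r` of `G_s`
      (∃ r, G.Marked s r ∧
        x ∈ G.oo s r r ∧ y ∈ G.oo s r r ∧ (G.auxTwo s r r).TwoEdgeTwinlessConn x y) ∨
      -- a graph in `S(H_{sr}, (d(r), r))` for a marked vertex `r` of `H_sᴿ`
      (∃ r d, (G.auxOne s s).reverse.Marked s r ∧ (G.auxOne s s).reverse.IsIdom s d r ∧
        ∃ A ∈ (G.auxTwo s s r).sOp d r,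
          x ∈ G.oo s s r ∩ A.verts ∧ y ∈ G.oo s s r ∩ A.verts ∧ A.TwoEdgeTwinlessConn x y) ∨
      -- a graph in `S(H_{rr'}, (d(r'), r'))` for marked vertices `r` of `G_s` and `r'` of `H_rᴿ`
      (∃ r r' d, G.Marked s r ∧
        (G.auxOne s r).reverse.Marked r r' ∧ (G.auxOne s r).reverse.IsIdom r d r' ∧
        ∃ A ∈ (G.auxTwo s r r').sOp d r',
          x ∈ G.oo s r r' ∩ A.verts ∧ y ∈ G.oo s r r' ∩ A.verts ∧
            A.TwoEdgeTwinlessConn x y) := by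
  open MultiDigraph in
  constructor
  · intro h
    obtain ⟨r, r', hr, hr', hxo, hyo⟩ := h.exists_oo hs hG
    rcases hr' with rfl | hr'
    · have h2 := (twoEdgeTwinlessConn_auxTwo hs hG hr (Or.inl rfl) hxo hyo).2 h
      rcases hr with rfl | hr
      · exact Or.inl ⟨hxo, hyo, h2⟩
      · exact Or.inr (Or.inl ⟨_, hr, hxo, hyo, h2⟩)
    · obtain ⟨d, hd⟩ := hr'
      have hi := hd.isIdom (root_mem_auxOne_reverse hs hG hr)
        (stronglyConnected_auxOne_reverse hs hG hr)
      obtain ⟨A, hA, hxA, hyA, h2⟩ := (exists_sOp_auxTwo_iff hs hG hr ⟨d, hd⟩ hi hxo hyo).2 h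
      rcases hr with rfl | hr
      · exact Or.inr (Or.inr (Or.inl ⟨r', d, ⟨d, hd⟩, hi, A, hA, ⟨hxo, hxA⟩, ⟨hyo, hyA⟩, h2⟩))
      · exact Or.inr (Or.inr (Or.inr
          ⟨r, r', d, hr, ⟨d, hd⟩, hi, A, hA, ⟨hxo, hxA⟩, ⟨hyo, hyA⟩, h2⟩))
  · rintro (⟨hxo, hyo, h⟩ | ⟨r, hr, hxo, hyo, h⟩ | ⟨r, d, hr, hd, A, hA, hxo, hyo, h⟩ |
      ⟨r, r', d, hr, hr', hd, A, hA, hxo, hyo, h⟩)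
    · exact (twoEdgeTwinlessConn_auxTwo hs hG (Or.inl rfl) (Or.inl rfl) hxo hyo).1 h
    · exact (twoEdgeTwinlessConn_auxTwo hs hG (Or.inr hr) (Or.inl rfl) hxo hyo).1 h
    · exact (exists_sOp_auxTwo_iff hs hG (Or.inl rfl) hr hd hxo.1 hyo.1).1
        ⟨A, hA, hxo.2, hyo.2, h⟩
    · exact (exists_sOp_auxTwo_iff hs hG (Or.inr hr) hr' hd hxo.1 hyo.1).1
        ⟨A, hA, hxo.2, hyo.2, h⟩
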